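/- For integers $1\le k<d$ let $\mathcal G_{k,d}$ be the Grassmann space of $k$-dimensional linear subspaces of $\mathbb R^d$ (with the topology obtained by identifying $V$ with its orthogonal projector $P_V$), and let $\sigma_k$ be the probability measure on $\mathcal G_{k,d}$ induced by the Haar measure of the orthogonal group $O(d)$. For $V_1,\dots,V_n\in\mathcal G_{k,d}$ and a symmetric matrix $X\in\mathbb R^{d\times d}$ put $$\mathcal F_n(X)=\frac dk\big(\operatorname{trace}(XP_{V_j})\big)_{j=1}^n\in\mathbb R^n .$$ Let $\|\cdot\|_{\ell_1}$ be the $\ell_1$ norm on $\mathbb R^n$ and $\|X\|_\infty$ the operator norm of $X$ with respect to the Euclidean norm. Theorem. For every $k\ge 1$ there is a constant $u_k>0$, depending only on $k$, such that for every $0<r<1$ there are constants $c(r),C(r)>0$ (which may depend on $k$, but not on $d$ or $n$) with the following property. For all integers $d>k$ and all $n\ge c(r)\,d$, if $V_1,\dots,V_n$ are independent random subspaces in $\mathcal G_{k,d}$ with distribution $\sigma_k$, then with probability at least $1-e^{-C(r)n}$ the inequality $$\frac1n\|\mathcal F_n(X)\|_{\ell_1}\ \ge\ u_k(1-r)\,\|X\|_\infty$$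 holds simultaneously for all symmetric matrices $X\in\mathbb R^{d\times d}$ of rank at most $2$. -/

import Mathlib

open MeasureTheory ProbabilityTheory

namespace PhaseRetrieval

/-- The real Grassmann space of `k`-dimensional linear subspaces of Euclidean `ℝ^d`. -/
structure Grassmannian (k d : ℕ) where
  toSubmodule : Submodule ℝ (EuclideanSpace ℝ (Fin d))
  finrank_eq : Module.finrank ℝ toSubmodule = k

/-- The matrix `P_V` of the orthogonal projector of `ℝ^d` onto `V`. -/
noncomputable def Grassmannian.proj {k d : ℕ} (V : Grassmannian k d) :
    Matrix (Fin d) (Fin d) ℝ :=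
  (Matrix.toEuclideanCLM (n := Fin d) (𝕜 := ℝ)).symm V.toSubmodule.starProjection

/-- Subspaces are identified with their orthogonal projectors; this is the topology it induces. -/
noncomputable instance {k d : ℕ} : TopologicalSpace (Grassmannian k d) :=
  TopologicalSpace.induced Grassmannian.proj inferInstance

noncomputable instance {k d : ℕ} : MeasurableSpace (Grassmannian k d) := borel _

instance {k d : ℕ} : BorelSpace (Grassmannian k d) := ⟨rfl⟩

noncomputable instance {d : ℕ} : MeasurableSpace (Matrix.orthogonalGroup (Fin d) ℝ) := borel _

instance {d : ℕ} : BorelSpace (Matrix.orthogonalGroup (Fin d) ℝ) := ⟨rfl⟩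

theorem isCompact_orthogonalGroup (d : ℕ) :
    IsCompact ((Matrix.orthogonalGroup (Fin d) ℝ : Submonoid (Matrix (Fin d) (Fin d) ℝ)) :
      Set (Matrix (Fin d) (Fin d) ℝ)) := by
  have hc : IsCompact (Set.univ.pi fun _ : Fin d => Set.univ.pi fun _ : Fin d =>
      Set.Icc (-1 : ℝ) 1) :=
    isCompact_univ_pi fun _ => isCompact_univ_pi fun _ => isCompact_Icc
  refine IsCompact.of_isClosed_subset hc ?_ ?_
  · have : ((Matrix.orthogonalGroup (Fin d) ℝ : Submonoid (Matrix (Fin d) (Fin d) ℝ)) :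
        Set (Matrix (Fin d) (Fin d) ℝ)) = {A | A * star A = 1} := by
      ext A
      exact Matrix.mem_unitaryGroup_iff
    rw [this]
    exact isClosed_eq (by fun_prop) continuous_const
  · intro A hA i _ j _
    have := entry_norm_bound_of_unitary hA i j
    rw [Real.norm_eq_abs] at this
    exact abs_le.mp this

instance {d : ℕ} : CompactSpace (Matrix.orthogonalGroup (Fin d) ℝ) :=
  isCompact_iff_compactSpace.mp (isCompact_orthogonalGroup d)

/-- The Haar measure of the orthogonal group `O(d)`, normalized to total mass `1`. -/
noncomputable def haarOrthogonal (d : ℕ) : Measure (Matrix.orthogonalGroup (Fin d) ℝ) :=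
  Measure.haarMeasure ⊤

/-- An orthogonal matrix as a linear automorphism of `ℝ^d`. -/
noncomputable def orthogonalEquiv {d : ℕ} (U : Matrix.orthogonalGroup (Fin d) ℝ) :
    EuclideanSpace ℝ (Fin d) ≃ₗ[ℝ] EuclideanSpace ℝ (Fin d) :=
  LinearEquiv.ofLinearMap (Matrix.toEuclideanLin (U : Matrix (Fin d) (Fin d) ℝ))
    (Matrix.toEuclideanLin (star (U : Matrix (Fin d) (Fin d) ℝ)))
    (by
      have h := congrArg (Matrix.toEuclideanCLM (n := Fin d) (𝕜 := ℝ))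
        (Matrix.mem_unitaryGroup_iff.mp U.2)
      rw [map_mul, map_one] at h
      ext1 x
      exact DFunLike.congr_fun h x)
    (by
      have h := congrArg (Matrix.toEuclideanCLM (n := Fin d) (𝕜 := ℝ))
        (Matrix.mem_unitaryGroup_iff'.mp U.2)
      rw [map_mul, map_one] at h
      ext1 x
      exact DFunLike.congr_fun h x)

/-- The action of the orthogonal group on the Grassmann space, `(U, V) ↦ U V`. -/
noncomputable def Grassmannian.rotate {k d : ℕ} (U : Matrix.orthogonalGroup (Fin d) ℝ)
    (V : Grassmannian k d) : Grassmannian k d :=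
  ⟨V.toSubmodule.map (orthogonalEquiv U).toLinearMap,
    (LinearEquiv.finrank_map_eq (orthogonalEquiv U) V.toSubmodule).trans V.finrank_eq⟩

theorem Grassmannian.proj_rotate {k d : ℕ} (U : Matrix.orthogonalGroup (Fin d) ℝ)
    (V : Grassmannian k d) :
    (V.rotate U).proj = (U : Matrix (Fin d) (Fin d) ℝ) * V.proj *
      star (U : Matrix (Fin d) (Fin d) ℝ) := by
  set T := Matrix.toEuclideanCLM (n := Fin d) (𝕜 := ℝ) with hT
  set u : Matrix (Fin d) (Fin d) ℝ := (U : Matrix (Fin d) (Fin d) ℝ) with hu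
  have hinv (x : EuclideanSpace ℝ (Fin d)) : T u (T (star u) x) = x := by
    have h := congrArg T (Matrix.mem_unitaryGroup_iff.mp U.2)
    rw [map_mul, map_one] at h
    exact DFunLike.congr_fun h x
  have hadj : T (star u) = (T u).adjoint := by
    rw [map_star]
    rfl
  apply (EquivLike.injective T)
  have hp (W : Grassmannian k d) : T W.proj = W.toSubmodule.starProjection :=
    T.apply_symm_apply _
  rw [map_mul, map_mul, hp, hp]
  ext1 x
  refine Submodule.eq_starProjection_of_mem_of_inner_eq_zero ?_ ?_
  · exact Submodule.mem_map.mpr ⟨_, Submodule.starProjection_apply_mem V.toSubmodule (T (star u) x), rfl⟩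
  · rintro w hw
    obtain ⟨v, hv, rfl⟩ := Submodule.mem_map.mp hw
    have h1 : (orthogonalEquiv U).toLinearMap v = T u v := rfl
    have h2 : (x - (T u * V.toSubmodule.starProjection * T (star u)) x) =
        T u (T (star u) x - V.toSubmodule.starProjection (T (star u) x)) := by
      rw [map_sub, hinv]
      rfl
    have h3 (y : EuclideanSpace ℝ (Fin d)) : T (star u) (T u y) = y := by
      have h := congrArg T (Matrix.mem_unitaryGroup_iff'.mp U.2)
      rw [map_mul, map_one] at h
      exact DFunLike.congr_fun h y
    rw [h1, h2, ← ContinuousLinearMap.adjoint_inner_left, ← hadj, h3]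
    exact Submodule.starProjection_inner_eq_zero _ v hv

theorem Grassmannian.continuous_rotate {k d : ℕ} (V : Grassmannian k d) :
    Continuous fun U : Matrix.orthogonalGroup (Fin d) ℝ => V.rotate U := by
  refine continuous_induced_rng.mpr ?_
  have : (Grassmannian.proj ∘ fun U : Matrix.orthogonalGroup (Fin d) ℝ => V.rotate U) =
      fun U : Matrix.orthogonalGroup (Fin d) ℝ => (U : Matrix (Fin d) (Fin d) ℝ) * V.proj * star (U : Matrix (Fin d) (Fin d) ℝ) :=
    funext fun U => V.proj_rotate U
  rw [this]
  fun_prop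

/-- The coordinate subspace spanned by the first `k` standard basis vectors of `ℝ^d`. -/
noncomputable def Grassmannian.coord {k d : ℕ} (h : k ≤ d) : Grassmannian k d :=
  ⟨Submodule.span ℝ (Set.range fun i : Fin k =>
      EuclideanSpace.basisFun (Fin d) ℝ (Fin.castLE h i)), by
    rw [finrank_span_eq_card, Fintype.card_fin]
    exact (EuclideanSpace.basisFun (Fin d) ℝ).orthonormal.linearIndependent.comp _
      (Fin.castLE_injective h)⟩

/-- The probability measure `σ_k` on the Grassmann space that is induced by the Haar measure of the
orthogonal group through the transitive action (the choice of base point is immaterial). -/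
noncomputable def sigma (k d : ℕ) (h : k ≤ d) : Measure (Grassmannian k d) :=
  (haarOrthogonal d).map fun U => (Grassmannian.coord h).rotate U

instance {d : ℕ} : IsProbabilityMeasure (haarOrthogonal d) :=
  ⟨Measure.haarMeasure_self (K₀ := (⊤ : TopologicalSpace.PositiveCompacts _))⟩

instance {k d : ℕ} (h : k ≤ d) : IsProbabilityMeasure (sigma k d h) :=
  Measure.isProbabilityMeasure_map
    (Grassmannian.coord h).continuous_rotate.measurable.aemeasurable

/-- The measurement operator `X ↦ (d / k) (⟨X, P_{V_j}⟩)_j`, where `⟨X, P⟩ = trace (X P)`. -/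
noncomputable def measurement {k d n : ℕ} (V : Fin n → Grassmannian k d)
    (X : Matrix (Fin d) (Fin d) ℝ) : Fin n → ℝ :=
  fun j => (d : ℝ) / (k : ℝ) * (X * (V j).proj).trace

/-- The operator norm of a matrix with respect to the Euclidean norm. -/
noncomputable def opNorm {d : ℕ} (X : Matrix (Fin d) (Fin d) ℝ) : ℝ :=
  ‖Matrix.toEuclideanCLM (n := Fin d) (𝕜 := ℝ) X‖

/-- The `ℓ¹` norm on `ℝ^n`. -/
noncomputable def l1Norm {n : ℕ} (y : Fin n → ℝ) : ℝ := ∑ j, |y j|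

end PhaseRetrieval

/-! A symmetric `X` of rank at most 2 is a(xxᵀ + t yyᵀ) with x, y orthonormal, |t| ≤ 1 and |a| ≥ ‖X‖
(`exists_eq_of_rank_le_two`). So it suffices to bound the mean of |Y_j| from below, uniformly in x,
y, t, where Y_j = (d/k)(⟨P_j x, x⟩ + t⟨P_j y, y⟩).

For fixed x, y, t the Y_j are i.i.d. Orthogonal invariance gives E Y² ≥ 1/k², whatever d and t
(`le_second_moment`). Comparison with sign vectors bounds an exponential moment of (d/k)⟨Px, x⟩
independently of k and d (`integral_exp_form_le`), hence E Y⁴ as well. A variable with second moment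
bounded below and fourth moment bounded above cannot concentrate at 0, so E exp(-s|Y|) is
quantitatively below 1 (`exists_exp_neg_abs_le`), and Chernoff's bound yields a lower tail exp(-κn)
(`exists_lower_tail`).

Uniformity comes from a net of exp(O(d)) pairs. Moving a pair by δ changes the ℓ¹ norm by O(δQ),
where Q bounds the energy (d/k)∑‖P_j x‖² on the unit ball (`sum_abs_form_sub_le`); Q = O(n) follows
from `upper_tail` on a 1/2-net. The union bound is absorbed once n ≥ c d. The constants found do not
depend on r: the factor 1 - r is pure slack. -/

namespace PhaseRetrieval

open scoped RealInnerProductSpace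

/-! ### Nets of exponential size in balls. -/

/-- A maximal `1`-separated subset of the ball of radius `2` is a `1`-net. -/
theorem exists_net_one (E : Type*) [NormedAddCommGroup E] [NormedSpace ℝ E]
    [FiniteDimensional ℝ E] :
    ∃ s : Finset E, s.card ≤ 5 ^ Module.finrank ℝ E ∧
      ∀ x : E, ‖x‖ ≤ 2 → ∃ y ∈ s, ‖x - y‖ ≤ 1 := by
  classical
  -- Maximality is in cardinality: `Besicovitch.card_le_of_separated` caps every such set at 5 ^
  -- dim, so `Nat.findGreatest` with that cap reaches the true maximum.
  let p : ℕ → Prop := fun n => ∃ s : Finset E, (∀ c ∈ s, ‖c‖ ≤ 2) ∧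
    (∀ c ∈ s, ∀ d ∈ s, c ≠ d → 1 ≤ ‖c - d‖) ∧ s.card = n
  have h0 : p 0 := ⟨∅, by simp, by simp, by simp⟩
  obtain ⟨s, hs, hsep, hcard⟩ : p (Nat.findGreatest p (5 ^ Module.finrank ℝ E)) :=
    Nat.findGreatest_spec (Nat.zero_le _) h0
  refine ⟨s, Besicovitch.card_le_of_separated s hs hsep, fun x hx => ?_⟩
  by_contra! hfar
  have hxs : x ∉ s := fun h => by
    have := hfar x h
    simp at this
    linarith
  have h1 : p (s.card + 1) := by
    refine ⟨insert x s, ?_, ?_, Finset.card_insert_of_notMem hxs⟩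
    · intro c hc
      rcases Finset.mem_insert.mp hc with rfl | hc
      · exact hx
      · exact hs c hc
    · intro c hc d hd hcd
      rcases Finset.mem_insert.mp hc with h | h <;> rcases Finset.mem_insert.mp hd with h' | h'
      · exact absurd (h.trans h'.symm) hcd
      · exact h ▸ (hfar d h').le
      · rw [norm_sub_rev]
        exact h' ▸ (hfar c h).le
      · exact hsep c h d h' hcd
  have h2 : s.card + 1 ≤ 5 ^ Module.finrank ℝ E := by
    obtain ⟨t, ht, htsep, htc⟩ := h1
    rw [← htc]
    exact Besicovitch.card_le_of_separated t ht htsep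
  have h3 := Nat.le_findGreatest h2 h1
  omega

/-- The unit ball of a finite-dimensional space has a `2⁻ᵐ`-net of size exponential in the
dimension. -/
theorem exists_net (E : Type*) [NormedAddCommGroup E] [NormedSpace ℝ E]
    [FiniteDimensional ℝ E] (m : ℕ) :
    ∃ s : Finset E, s.card ≤ (5 ^ m) ^ Module.finrank ℝ E ∧
      ∀ x : E, ‖x‖ ≤ 1 → ∃ y ∈ s, ‖x - y‖ ≤ (1 / 2) ^ m := by
  classical
  induction m with
  | zero => exact ⟨{0}, by simp, fun x hx => ⟨0, by simp, by simpa using hx⟩⟩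
  | succ m ih =>
    obtain ⟨s, hs, hnet⟩ := ih
    obtain ⟨t, ht, htnet⟩ := exists_net_one E
    refine ⟨(s ×ˢ t).image fun p => p.1 + ((1 / 2 : ℝ) ^ (m + 1)) • p.2, ?_, fun x hx => ?_⟩
    · refine Finset.card_image_le.trans ?_
      rw [Finset.card_product, pow_succ, mul_pow]
      exact Nat.mul_le_mul hs ht
    · obtain ⟨y, hy, hxy⟩ := hnet x hx
      have h2 : ((2 : ℝ) ^ (m + 1)) * (1 / 2) ^ (m + 1) = 1 := by
        rw [← mul_pow]; norm_num
      -- The error of the coarser net, rescaled by 2 ^ (m + 1), has norm at most 2; hence the basic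
      -- net covers radius 2 rather than 1.
      obtain ⟨z, hz, hz1⟩ := htnet (((2 : ℝ) ^ (m + 1)) • (x - y)) (by
        rw [norm_smul, Real.norm_of_nonneg (by positivity)]
        calc (2 : ℝ) ^ (m + 1) * ‖x - y‖ ≤ 2 ^ (m + 1) * (1 / 2) ^ m := by gcongr
          _ = 2 := by rw [pow_succ, mul_right_comm, ← mul_pow]; norm_num)
      refine ⟨_, Finset.mem_image.mpr ⟨(y, z), Finset.mk_mem_product hy hz, rfl⟩, ?_⟩
      have : x - (y + ((1 / 2 : ℝ) ^ (m + 1)) • z) =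
          ((1 / 2 : ℝ) ^ (m + 1)) • (((2 : ℝ) ^ (m + 1)) • (x - y) - z) := by
        rw [smul_sub, smul_smul, mul_comm, h2, one_smul, sub_sub]
      rw [this, norm_smul, Real.norm_of_nonneg (by positivity)]
      exact mul_le_of_le_one_right (by positivity) hz1

/-! ### Chernoff bound. -/

/-- The Chernoff bound for independent and identically distributed samples. -/
theorem measureReal_le_of_iid {Ω G : Type*} [MeasurableSpace Ω] [MeasurableSpace G]
    {P : Measure Ω} {σ : Measure G} {n : ℕ} {V : Fin n → Ω → G} (hind : iIndepFun V P)
    (hlaw : ∀ j, HasLaw (V j) σ P) {f : G → ℝ} (hf : Measurable f) {M : ℝ}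
    (hM : ∀ x, f x ≤ M) (a : ℝ) :
    P.real {ω | (n : ℝ) * a ≤ ∑ j, f (V j ω)} ≤
      (Real.exp (-a) * ∫ x, Real.exp (f x) ∂σ) ^ n := by
  have := hind.isProbabilityMeasure
  have hind' : iIndepFun (fun j ω => f (V j ω)) P := hind.comp (fun _ => f) (fun _ => hf)
  have hm : ∀ j, AEMeasurable (fun ω => f (V j ω)) P := fun j =>
    hf.comp_aemeasurable (hlaw j).aemeasurable
  have hI : Integrable (fun ω => Real.exp (1 * (∑ j, fun ω => f (V j ω)) ω)) P := by
    refine Integrable.of_bound (C := Real.exp (n * M)) ?_ (ae_of_all _ fun ω => ?_)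
    · have : AEMeasurable (∑ j, fun ω => f (V j ω)) P := Finset.aemeasurable_sum _ fun j _ => hm j
      exact (Real.measurable_exp.comp_aemeasurable (this.const_mul 1)).aestronglyMeasurable
    · rw [Real.norm_of_nonneg (Real.exp_pos _).le, Real.exp_le_exp, one_mul, Finset.sum_apply]
      refine (Finset.sum_le_sum fun j _ => hM (V j ω)).trans (le_of_eq ?_)
      simp
  have h := measure_ge_le_exp_mul_mgf (μ := P) (t := 1) ((n : ℝ) * a) zero_le_one hI
  rw [hind'.mgf_sum₀ hm] at h
  have hmgf : ∀ j, mgf (fun ω => f (V j ω)) P 1 = ∫ x, Real.exp (f x) ∂σ := fun j => by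
    simp only [mgf, one_mul]
    exact (hlaw j).integral_comp (f := fun x => Real.exp (f x))
      (Real.measurable_exp.comp hf).aestronglyMeasurable
  simp only [hmgf, Finset.prod_const, Finset.card_univ, Fintype.card_fin, Finset.sum_apply] at h
  refine h.trans (le_of_eq ?_)
  rw [mul_pow, ← Real.exp_nat_mul]
  ring_nf

/-! ### The quadratic form of a projector and its orthogonal invariance. -/

namespace Grassmannian

variable {k d : ℕ}

/-- The bilinear form `(x, y) ↦ ⟨P_V x, y⟩` of the orthogonal projector onto `V`. -/
noncomputable def form (V : Grassmannian k d) (x y : EuclideanSpace ℝ (Fin d)) : ℝ :=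
  ⟪x, V.toSubmodule.starProjection y⟫

theorem form_eq_dotProduct (V : Grassmannian k d) (x y : EuclideanSpace ℝ (Fin d)) :
    V.form x y = x.ofLp ⬝ᵥ V.proj.mulVec y.ofLp := by
  rw [form, ← Matrix.inner_toEuclideanCLM, proj, StarAlgEquiv.apply_symm_apply]

theorem form_comm (V : Grassmannian k d) (x y : EuclideanSpace ℝ (Fin d)) :
    V.form x y = V.form y x := by
  rw [form, form, ← Submodule.inner_starProjection_left_eq_right, real_inner_comm]

theorem form_add_left (V : Grassmannian k d) (x y z : EuclideanSpace ℝ (Fin d)) :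
    V.form (x + y) z = V.form x z + V.form y z := inner_add_left _ _ _

theorem form_sub_left (V : Grassmannian k d) (x y z : EuclideanSpace ℝ (Fin d)) :
    V.form (x - y) z = V.form x z - V.form y z := inner_sub_left _ _ _

theorem form_smul_left (V : Grassmannian k d) (a : ℝ) (x z : EuclideanSpace ℝ (Fin d)) :
    V.form (a • x) z = a * V.form x z := real_inner_smul_left _ _ _

theorem form_add_right (V : Grassmannian k d) (x y z : EuclideanSpace ℝ (Fin d)) :
    V.form x (y + z) = V.form x y + V.form x z := by
  rw [form_comm, form_add_left, form_comm V y, form_comm V z]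

theorem form_sub_right (V : Grassmannian k d) (x y z : EuclideanSpace ℝ (Fin d)) :
    V.form x (y - z) = V.form x y - V.form x z := by
  rw [form_comm, form_sub_left, form_comm V y, form_comm V z]

theorem form_smul_right (V : Grassmannian k d) (a : ℝ) (x z : EuclideanSpace ℝ (Fin d)) :
    V.form x (a • z) = a * V.form x z := by
  rw [form_comm, form_smul_left, form_comm]

theorem form_self (V : Grassmannian k d) (x : EuclideanSpace ℝ (Fin d)) :
    V.form x x = ‖V.toSubmodule.starProjection x‖ ^ 2 := by
  rw [form, ← Submodule.inner_starProjection_left_eq_right,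
    ← V.toSubmodule.starProjection_eq_self_iff.mpr (V.toSubmodule.starProjection_apply_mem x),
    Submodule.inner_starProjection_left_eq_right,
    V.toSubmodule.starProjection_eq_self_iff.mpr (V.toSubmodule.starProjection_apply_mem x),
    real_inner_self_eq_norm_sq]

theorem form_self_nonneg (V : Grassmannian k d) (x : EuclideanSpace ℝ (Fin d)) :
    0 ≤ V.form x x := by
  rw [form_self]
  positivity

theorem abs_form_le (V : Grassmannian k d) (x y : EuclideanSpace ℝ (Fin d)) :
    |V.form x y| ≤ ‖x‖ * ‖y‖ :=
  (abs_real_inner_le_norm _ _).trans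
    (mul_le_mul_of_nonneg_left (Submodule.norm_starProjection_apply_le _ _) (norm_nonneg _))

theorem form_self_le (V : Grassmannian k d) (x : EuclideanSpace ℝ (Fin d)) :
    V.form x x ≤ ‖x‖ ^ 2 := by
  rw [sq]
  exact (le_abs_self _).trans (V.abs_form_le x x)

theorem continuous_form (x y : EuclideanSpace ℝ (Fin d)) :
    Continuous fun V : Grassmannian k d => V.form x y := by
  simp only [form_eq_dotProduct]
  have : Continuous (proj : Grassmannian k d → _) := continuous_induced_dom
  fun_prop

@[fun_prop]
theorem measurable_form (x y : EuclideanSpace ℝ (Fin d)) :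
    Measurable fun V : Grassmannian k d => V.form x y :=
  (continuous_form x y).measurable

/-- The form of the projector, written in an orthonormal basis of the subspace. -/
theorem exists_form_eq_sum (V : Grassmannian k d) :
    ∃ v : Fin k → EuclideanSpace ℝ (Fin d), (∀ l, ‖v l‖ = 1) ∧
      ∀ x y, V.form x y = ∑ l, ⟪v l, x⟫ * ⟪v l, y⟫ := by
  let b := (stdOrthonormalBasis ℝ V.toSubmodule).reindex (finCongr V.finrank_eq)
  refine ⟨fun l => b l, fun l => ?_, fun x y => ?_⟩
  · exact b.orthonormal.1 l
  · rw [form, b.starProjection_eq_sum_rankOne]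
    simp only [sum_apply, InnerProductSpace.rankOne_apply, inner_sum,
      real_inner_smul_right]
    exact Finset.sum_congr rfl fun l _ => by rw [mul_comm, real_inner_comm]

theorem sum_form_self {ι : Type*} [Fintype ι] (V : Grassmannian k d)
    (b : OrthonormalBasis ι ℝ (EuclideanSpace ℝ (Fin d))) : ∑ i, V.form (b i) (b i) = k := by
  obtain ⟨v, hv, h⟩ := V.exists_form_eq_sum
  simp only [h, ← sq]
  rw [Finset.sum_comm]
  simp [b.sum_sq_inner_left, hv]

/-- The squared Hilbert–Schmidt norm of a projector equals its trace. -/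
theorem sum_form_sq {ι : Type*} [Fintype ι] (V : Grassmannian k d)
    (b : OrthonormalBasis ι ℝ (EuclideanSpace ℝ (Fin d))) :
    ∑ i, ∑ j, V.form (b i) (b j) ^ 2 = k := by
  rw [← V.sum_form_self b]
  refine Finset.sum_congr rfl fun i _ => ?_
  rw [form_self, ← b.sum_sq_inner_left]
  simp [form, Submodule.inner_starProjection_left_eq_right]

theorem measurable_rotate (W : Matrix.orthogonalGroup (Fin d) ℝ) :
    Measurable fun V : Grassmannian k d => V.rotate W := by
  refine Continuous.measurable (continuous_induced_rng.mpr ?_)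
  have h : Continuous (proj : Grassmannian k d → _) := continuous_induced_dom
  have : (proj ∘ fun V : Grassmannian k d => V.rotate W) =
      fun V : Grassmannian k d => (W : Matrix (Fin d) (Fin d) ℝ) * V.proj *
        star (W : Matrix (Fin d) (Fin d) ℝ) := funext fun V => V.proj_rotate W
  rw [this]
  fun_prop

theorem rotate_rotate (U W : Matrix.orthogonalGroup (Fin d) ℝ) (V : Grassmannian k d) :
    (V.rotate U).rotate W = V.rotate (W * U) := by
  have h : (orthogonalEquiv (W * U)).toLinearMap =
      (orthogonalEquiv W).toLinearMap ∘ₗ (orthogonalEquiv U).toLinearMap := by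
    ext x : 1
    have := congrArg (fun f => f x)
      (map_mul (Matrix.toEuclideanCLM (n := Fin d) (𝕜 := ℝ)) W.1 U.1)
    exact this
  simp only [rotate, h, Submodule.map_comp]

/-- Left invariance of Haar measure, transported along the orbit map by `rotate_rotate`. -/
theorem map_rotate_sigma (h : k ≤ d) (W : Matrix.orthogonalGroup (Fin d) ℝ) :
    (sigma k d h).map (fun V => V.rotate W) = sigma k d h := by
  have hm := (coord h).continuous_rotate.measurable
  have : (haarOrthogonal d).map (fun U => W * U) = haarOrthogonal d := by
    unfold haarOrthogonal
    exact map_mul_left_eq_self _ W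
  rw [sigma, Measure.map_map (measurable_rotate W) hm]
  conv_rhs => rw [← this]
  rw [Measure.map_map hm (measurable_const_mul W)]
  congr 1
  funext U
  exact rotate_rotate U W _

theorem form_rotate (W : Matrix.orthogonalGroup (Fin d) ℝ) (R : EuclideanSpace ℝ (Fin d) ≃ₗᵢ[ℝ]
    EuclideanSpace ℝ (Fin d)) (hR : ∀ x, orthogonalEquiv W x = R x) (V : Grassmannian k d)
    (x y : EuclideanSpace ℝ (Fin d)) : (V.rotate W).form (R x) (R y) = V.form x y := by
  have h : (orthogonalEquiv W).toLinearMap = R.toLinearEquiv.toLinearMap := by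
    ext x : 1
    exact hR x
  simp only [form, rotate, h]
  rw [Submodule.starProjection_map_apply, R.symm_apply_apply, R.inner_map_map]

theorem exists_orthogonalEquiv_eq (R : EuclideanSpace ℝ (Fin d) ≃ₗᵢ[ℝ]
    EuclideanSpace ℝ (Fin d)) :
    ∃ W : Matrix.orthogonalGroup (Fin d) ℝ, ∀ x, orthogonalEquiv W x = R x := by
  let T := Matrix.toEuclideanCLM (n := Fin d) (𝕜 := ℝ)
  refine ⟨⟨T.symm (Unitary.linearIsometryEquiv.symm R : _ →L[ℝ] _),
    Unitary.map_mem T.symm (Unitary.linearIsometryEquiv.symm R).2⟩, fun x => ?_⟩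
  have := congrArg (fun f => f x)
    (T.apply_symm_apply (Unitary.linearIsometryEquiv.symm R : _ →L[ℝ] _))
  exact this

/-- The law of the form of a random projector is invariant under linear isometries. -/
theorem integral_form_isometry {ι : Type*} [Finite ι] (h : k ≤ d)
    (R : EuclideanSpace ℝ (Fin d) ≃ₗᵢ[ℝ] EuclideanSpace ℝ (Fin d)) (x y : ι → EuclideanSpace ℝ (Fin d)) (F : (ι → ℝ) → ℝ)
    (hF : Measurable F) :
    ∫ V, F (fun i => V.form (R (x i)) (R (y i))) ∂sigma k d h =
      ∫ V, F (fun i => V.form (x i) (y i)) ∂sigma k d h := by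
  obtain ⟨W, hW⟩ := exists_orthogonalEquiv_eq R
  conv_lhs => rw [← map_rotate_sigma h W]
  rw [integral_map (measurable_rotate W).aemeasurable]
  · simp only [form_rotate W R hW]
  · exact (hF.comp (measurable_pi_lambda _ fun i => measurable_form _ _)).aestronglyMeasurable

end Grassmannian

/-! ### Second moments of a random projector. -/

theorem exists_orthonormalBasis_pair {d : ℕ} {x y : EuclideanSpace ℝ (Fin d)} (hx : ‖x‖ = 1)
    (hy : ‖y‖ = 1) (hxy : ⟪x, y⟫ = 0) {i j : Fin d} (hij : i ≠ j) :
    ∃ b : OrthonormalBasis (Fin d) ℝ (EuclideanSpace ℝ (Fin d)), b i = x ∧ b j = y := by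
  classical
  let v : Fin d → EuclideanSpace ℝ (Fin d) := fun l => if l = i then x else y
  have hv : Orthonormal ℝ (({i, j} : Set (Fin d)).domRestrict v) := by
    constructor
    · rintro ⟨l, hl⟩
      rcases hl with rfl | rfl
      · simp [v, hx]
      · simp [v, hij.symm, hy]
    · rintro ⟨l, hl⟩ ⟨m, hm⟩ hlm
      have hlm' : l ≠ m := fun h => hlm (Subtype.ext h)
      rcases hl with rfl | rfl <;> rcases hm with rfl | rfl
      · exact absurd rfl hlm'
      · simp [v, hij.symm, hxy]
      · simp [v, hij.symm, real_inner_comm, hxy]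
      · exact absurd rfl hlm'
  obtain ⟨b, hb⟩ := hv.exists_orthonormalBasis_extension_of_card_eq (by simp)
  exact ⟨b, by simpa [v] using hb i (by simp), by simpa [v, hij.symm] using hb j (by simp)⟩

/-- Transitivity on orthonormal pairs: moments of the form on such a pair do not depend on the pair.
-/
theorem exists_isometry_pair {d : ℕ} (hd : 2 ≤ d) {x y x' y' : EuclideanSpace ℝ (Fin d)}
    (hx : ‖x‖ = 1) (hy : ‖y‖ = 1) (hxy : ⟪x, y⟫ = 0) (hx' : ‖x'‖ = 1) (hy' : ‖y'‖ = 1)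
    (hxy' : ⟪x', y'⟫ = 0) :
    ∃ R : EuclideanSpace ℝ (Fin d) ≃ₗᵢ[ℝ] EuclideanSpace ℝ (Fin d), R x = x' ∧ R y = y' := by
  have hij : (⟨0, by omega⟩ : Fin d) ≠ ⟨1, by omega⟩ := by simp
  obtain ⟨b, rfl, rfl⟩ := exists_orthonormalBasis_pair hx hy hxy hij
  obtain ⟨b', rfl, rfl⟩ := exists_orthonormalBasis_pair hx' hy' hxy' hij
  exact ⟨b.equiv b' (Equiv.refl _), by simp, by simp⟩

namespace Grassmannian

variable {k d : ℕ}

theorem integrable_form_mul_form (h : k ≤ d) (x y z w : EuclideanSpace ℝ (Fin d)) :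
    Integrable (fun V : Grassmannian k d => V.form x y * V.form z w) (sigma k d h) := by
  refine Integrable.of_bound (C := (‖x‖ * ‖y‖) * (‖z‖ * ‖w‖))
    ((measurable_form x y).mul (measurable_form z w)).aestronglyMeasurable
    (ae_of_all _ fun V => ?_)
  rw [Real.norm_eq_abs, abs_mul]
  exact mul_le_mul (V.abs_form_le x y) (V.abs_form_le z w) (abs_nonneg _) (by positivity)

theorem integral_form_quadratic (h : k ≤ d) (x y : EuclideanSpace ℝ (Fin d)) (a b c : ℝ) :
    ∫ V, (a * (V.form x x * V.form x x) + b * (V.form x x * V.form y y) +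
      c * (V.form y y * V.form y y)) ∂sigma k d h =
    a * (∫ V, V.form x x * V.form x x ∂sigma k d h) +
      b * (∫ V, V.form x x * V.form y y ∂sigma k d h) +
      c * (∫ V, V.form y y * V.form y y ∂sigma k d h) := by
  have h1 := (integrable_form_mul_form h x x x x).const_mul a
  have h2 := (integrable_form_mul_form h x x y y).const_mul b
  have h3 := (integrable_form_mul_form h y y y y).const_mul c
  have h12 : Integrable (fun V : Grassmannian k d => a * (V.form x x * V.form x x) +
    b * (V.form x x * V.form y y)) (sigma k d h) := h1.add h2
  rw [integral_add h12 h3, integral_add h1 h2, integral_const_mul, integral_const_mul,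
    integral_const_mul]

theorem sum_diag_offDiag (A D : ℝ) :
    ∑ i : Fin d, ∑ j : Fin d, (if i = j then A else D) = d * (A + (d - 1) * D) := by
  have : ∀ i j : Fin d, (if i = j then A else D) = D + if i = j then A - D else 0 := by
    intro i j
    split_ifs <;> ring
  simp only [this, Finset.sum_add_distrib]
  simp
  ring

/-- The second moments of the form of a random projector. -/
theorem second_moments (hd : 2 ≤ d) (h : k ≤ d) {x y : EuclideanSpace ℝ (Fin d)}
    (hx : ‖x‖ = 1) (hy : ‖y‖ = 1) (hxy : ⟪x, y⟫ = 0) :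
    ∃ A B : ℝ, (∫ V, V.form x x * V.form x x ∂sigma k d h) = A ∧
      (∫ V, V.form y y * V.form y y ∂sigma k d h) = A ∧
      (∫ V, V.form x x * V.form y y ∂sigma k d h) = B ∧
      (A - B) * (d * (d - 1) * (d + 2)) = 2 * (k * (d - k)) := by
  have hij : (⟨0, by omega⟩ : Fin d) ≠ ⟨1, by omega⟩ := by simp
  obtain ⟨b, hb0, hb1⟩ := exists_orthonormalBasis_pair hx hy hxy hij
  have key : ∀ {x' y' : EuclideanSpace ℝ (Fin d)}, ‖x'‖ = 1 → ‖y'‖ = 1 → ⟪x', y'⟫ = 0 →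
      (∫ V, V.form x' x' * V.form x' x' ∂sigma k d h) =
        (∫ V, V.form x x * V.form x x ∂sigma k d h) ∧
      (∫ V, V.form x' x' * V.form y' y' ∂sigma k d h) =
        (∫ V, V.form x x * V.form y y ∂sigma k d h) ∧
      (∫ V, V.form x' y' * V.form x' y' ∂sigma k d h) =
        (∫ V, V.form x y * V.form x y ∂sigma k d h) := by
    intro x' y' hx' hy' hxy'
    obtain ⟨R, rfl, rfl⟩ := exists_isometry_pair hd hx hy hxy hx' hy' hxy'
    have h1 := integral_form_isometry h R ![x, x, y] ![x, y, y] (fun u => u 0 * u 0)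
      (by fun_prop)
    have h2 := integral_form_isometry h R ![x, x, y] ![x, y, y] (fun u => u 0 * u 2)
      (by fun_prop)
    have h3 := integral_form_isometry h R ![x, x, y] ![x, y, y] (fun u => u 1 * u 1)
      (by fun_prop)
    exact ⟨by simpa using h1, by simpa using h2, by simpa using h3⟩
  set A := ∫ V, V.form x x * V.form x x ∂sigma k d h with hA
  set B := ∫ V, V.form x x * V.form y y ∂sigma k d h with hB
  set D := ∫ V, V.form x y * V.form x y ∂sigma k d h with hD
  have hbij : ∀ i j, i ≠ j → ⟪b i, b j⟫ = 0 := fun i j hij => b.orthonormal.2 hij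
  have hAi : ∀ i, (∫ V, V.form (b i) (b i) * V.form (b i) (b i) ∂sigma k d h) = A := by
    intro i
    obtain ⟨j, hj⟩ : ∃ j, i ≠ j := by
      by_cases hi : i = ⟨0, by omega⟩
      · exact ⟨⟨1, by omega⟩, hi ▸ hij⟩
      · exact ⟨_, hi⟩
    exact (key (b.orthonormal.1 i) (b.orthonormal.1 j) (hbij i j hj)).1
  -- The integrated Hilbert–Schmidt identity; by `key` only one diagonal and one off-diagonal value
  -- occur.
  have e1 : (d : ℝ) * (A + (d - 1) * D) = k := by
    have h1 : ∫ V, ∑ i, ∑ j, V.form (b i) (b j) * V.form (b i) (b j) ∂sigma k d h = k := by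
      simp [← sq, sum_form_sq]
    rw [integral_finsetSum _ fun i _ => integrable_finsetSum _ fun j _ =>
      integrable_form_mul_form h _ _ _ _] at h1
    rw [← h1, ← sum_diag_offDiag]
    refine Finset.sum_congr rfl fun i _ => ?_
    rw [integral_finsetSum _ fun j _ => integrable_form_mul_form h _ _ _ _]
    refine Finset.sum_congr rfl fun j _ => ?_
    split_ifs with hij'
    · rw [← hij', hAi]
    · exact (key (b.orthonormal.1 i) (b.orthonormal.1 j) (hbij i j hij')).2.2.symm
  -- The integrated square of the trace identity.
  have e2 : (d : ℝ) * (A + (d - 1) * B) = k ^ 2 := by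
    have h1 : ∫ V, ∑ i, ∑ j, V.form (b i) (b i) * V.form (b j) (b j) ∂sigma k d h = k ^ 2 := by
      simp [← Finset.sum_mul_sum, sum_form_self, sq]
    rw [integral_finsetSum _ fun i _ => integrable_finsetSum _ fun j _ =>
      integrable_form_mul_form h _ _ _ _] at h1
    rw [← h1, ← sum_diag_offDiag]
    refine Finset.sum_congr rfl fun i _ => ?_
    rw [integral_finsetSum _ fun j _ => integrable_form_mul_form h _ _ _ _]
    refine Finset.sum_congr rfl fun j _ => ?_
    split_ifs with hij'
    · rw [← hij', hAi]
    · exact (key (b.orthonormal.1 i) (b.orthonormal.1 j) (hbij i j hij')).2.1.symm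
  have hAy : (∫ V, V.form y y * V.form y y ∂sigma k d h) = A :=
    (key hy hx (by rw [real_inner_comm, hxy])).1
  have hyx : ⟪y, x⟫ = 0 := by rw [real_inner_comm, hxy]
  -- Rotation of the pair by 45° turns the off-diagonal form into half the difference of the
  -- diagonal ones, so D = (2A - 2B)/4.
  have e3 : A - B = 2 * D := by
    have hc : (√2⁻¹ : ℝ) * √2⁻¹ = 1 / 2 := by
      rw [Real.mul_self_sqrt (by positivity)]; norm_num
    have n1 : ‖√2⁻¹ • (x + y)‖ = 1 := by
      rw [← sq_eq_sq₀ (norm_nonneg _) zero_le_one, ← real_inner_self_eq_norm_sq,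
        real_inner_smul_left, real_inner_smul_right, ← mul_assoc, hc]
      simp only [inner_add_left, inner_add_right, hxy, hyx, real_inner_self_eq_norm_sq, hx, hy]
      norm_num
    have n2 : ‖√2⁻¹ • (x - y)‖ = 1 := by
      rw [← sq_eq_sq₀ (norm_nonneg _) zero_le_one, ← real_inner_self_eq_norm_sq,
        real_inner_smul_left, real_inner_smul_right, ← mul_assoc, hc]
      simp only [inner_sub_left, inner_sub_right, hxy, hyx, real_inner_self_eq_norm_sq, hx, hy]
      norm_num
    have n3 : ⟪√2⁻¹ • (x + y), √2⁻¹ • (x - y)⟫ = 0 := by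
      rw [real_inner_smul_left, real_inner_smul_right]
      simp only [inner_add_left, inner_sub_right, hxy, hyx, real_inner_self_eq_norm_sq, hx, hy]
      norm_num
    have h1 := (key n1 n2 n3).2.2
    have h2 : ∀ V : Grassmannian k d, V.form (√2⁻¹ • (x + y)) (√2⁻¹ • (x - y)) =
        1 / 2 * (V.form x x - V.form y y) := by
      intro V
      rw [form_smul_left, form_smul_right, ← mul_assoc, hc, form_add_left, form_sub_right,
        form_sub_right, form_comm V y x]
      ring
    have h3 : ∀ V : Grassmannian k d, 1 / 2 * (V.form x x - V.form y y) *
        (1 / 2 * (V.form x x - V.form y y)) = 1 / 4 * (V.form x x * V.form x x) +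
          (-1 / 2) * (V.form x x * V.form y y) + 1 / 4 * (V.form y y * V.form y y) :=
      fun V => by ring
    simp only [h2, h3] at h1
    rw [integral_form_quadratic, hAy, ← hA, ← hB] at h1
    linarith
  refine ⟨A, B, rfl, hAy, rfl, ?_⟩
  obtain hD' : D = (A - B) / 2 := by linarith
  rw [hD'] at e1
  linear_combination (2 : ℝ) * d * e1 - 2 * e2

/-- A lower bound, independent of the dimension, for the second moment of a measurement of
`x xᵀ + t y yᵀ`. -/
theorem le_second_moment (hk : 1 ≤ k) (h : k < d) {x y : EuclideanSpace ℝ (Fin d)}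
    (hx : ‖x‖ = 1) (hy : ‖y‖ = 1) (hxy : ⟪x, y⟫ = 0) (t : ℝ) :
    1 / (k : ℝ) ^ 2 ≤
      ∫ V, ((d : ℝ) / k * (V.form x x + t * V.form y y)) ^ 2 ∂sigma k d h.le := by
  obtain ⟨A, B, hA, hA', hB, hAB⟩ := second_moments (by omega) h.le hx hy hxy
  have hk' : (1 : ℝ) ≤ k := by exact_mod_cast hk
  have hd' : (k : ℝ) + 1 ≤ d := by exact_mod_cast h
  have hB0 : 0 ≤ B := hB ▸ integral_nonneg fun V =>
    mul_nonneg (V.form_self_nonneg x) (V.form_self_nonneg y)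
  have hI : ∫ V, ((d : ℝ) / k * (V.form x x + t * V.form y y)) ^ 2 ∂sigma k d h.le =
      ((d : ℝ) / k) ^ 2 * (A + (2 * t) * B + t ^ 2 * A) := by
    have : ∀ V : Grassmannian k d, ((d : ℝ) / k * (V.form x x + t * V.form y y)) ^ 2 =
        ((d : ℝ) / k) ^ 2 * (V.form x x * V.form x x) +
          (((d : ℝ) / k) ^ 2 * (2 * t)) * (V.form x x * V.form y y) +
          (((d : ℝ) / k) ^ 2 * t ^ 2) * (V.form y y * V.form y y) := fun V => by ring
    simp only [this]
    rw [integral_form_quadratic, hA, hA', hB]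
    ring
  have hden : (0 : ℝ) < d * (d - 1) * (d + 2) :=
    mul_pos (mul_pos (by linarith) (by linarith)) (by linarith)
  have hABeq : A - B = 2 * (k * (d - k)) / (d * (d - 1) * (d + 2)) := by
    rw [eq_div_iff hden.ne', hAB]
  have hAB0 : 0 ≤ A - B := by
    rw [hABeq]
    exact div_nonneg (mul_nonneg zero_le_two (mul_nonneg (by linarith) (by linarith))) hden.le
  -- The difference of the two sides is B(t + 1)² + t²(A - B).
  have h1 : A - B ≤ A + (2 * t) * B + t ^ 2 * A := by
    nlinarith [mul_nonneg hB0 (sq_nonneg (t + 1)), mul_nonneg hAB0 (sq_nonneg t)]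
  rw [hI]
  refine le_trans ?_ (mul_le_mul_of_nonneg_left h1 (sq_nonneg _))
  have h2 : ((d : ℝ) / k) ^ 2 * (A - B) = 2 * d * (d - k) * k / ((d - 1) * (d + 2)) / k ^ 2 := by
    rw [hABeq]
    have : (d : ℝ) ≠ 0 := by linarith
    have : (d : ℝ) - 1 ≠ 0 := by linarith
    field_simp
  rw [h2]
  refine div_le_div_of_nonneg_right ?_ (sq_nonneg _)
  rw [le_div_iff₀ (mul_pos (by linarith) (by linarith))]
  -- The product is k(d - k) - (d - 1) ≥ 0; then 2d(d - 1) ≥ (d - 1)(d + 2) suffices, as d ≥ 2.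
  nlinarith [mul_nonneg (sub_nonneg.mpr hk') (sub_nonneg.mpr hd')]

end Grassmannian

/-! ### Exponential moment of a random projection, through Rademacher vectors. -/

/-- The sign vectors in `ℝ^d`. -/
noncomputable def signs (d : ℕ) : Finset (Fin d → ℝ) := Fintype.piFinset fun _ => {1, -1}

theorem card_signs (d : ℕ) : (signs d).card = 2 ^ d := by
  have : ({1, -1} : Finset ℝ).card = 2 := Finset.card_pair (by norm_num)
  simp [signs, this]

theorem sq_of_mem_signs {d : ℕ} {ε : Fin d → ℝ} (hε : ε ∈ signs d) (i : Fin d) : ε i ^ 2 = 1 := by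
  have := Fintype.mem_piFinset.mp hε i
  rcases Finset.mem_insert.mp this with h | h
  · simp [h]
  · simp [Finset.mem_singleton.mp h]

/-- The sum factorizes over the coordinates, and cosh s ≤ exp(s²/2) handles each factor. -/
theorem sum_signs_exp_le {d : ℕ} (v : EuclideanSpace ℝ (Fin d)) (hv : ‖v‖ ≤ 1) (t : ℝ) :
    ∑ ε ∈ signs d, Real.exp (t * ⟪v, WithLp.toLp 2 ε⟫) ≤ 2 ^ d * Real.exp (t ^ 2 / 2) := by
  have h1 : ∀ ε : Fin d → ℝ, Real.exp (t * ⟪v, WithLp.toLp 2 ε⟫) =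
      ∏ i, Real.exp (t * v i * ε i) := by
    intro ε
    rw [← Real.exp_sum, PiLp.inner_apply, Finset.mul_sum]
    congr 1
    refine Finset.sum_congr rfl fun i _ => ?_
    simp
    ring
  have h2 : ∀ i : Fin d, ∑ a ∈ ({1, -1} : Finset ℝ), Real.exp (t * v i * a) ≤
      2 * Real.exp (t ^ 2 / 2 * v i ^ 2) := by
    intro i
    rw [Finset.sum_pair (by norm_num)]
    have := Real.cosh_le_exp_half_sq (t * v i)
    rw [Real.cosh_eq] at this
    rw [mul_one, mul_neg_one, show t ^ 2 / 2 * v i ^ 2 = (t * v i) ^ 2 / 2 by ring]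
    linarith
  simp only [h1]
  rw [signs, ← Finset.prod_univ_sum (fun _ => {1, -1}) fun i a => Real.exp (t * v i * a)]
  calc ∏ i, ∑ a ∈ ({1, -1} : Finset ℝ), Real.exp (t * v i * a)
      ≤ ∏ i : Fin d, 2 * Real.exp (t ^ 2 / 2 * v i ^ 2) :=
        Finset.prod_le_prod (fun i _ => Finset.sum_nonneg fun a _ => (Real.exp_pos _).le)
          fun i _ => h2 i
    _ = 2 ^ d * Real.exp (t ^ 2 / 2 * ‖v‖ ^ 2) := by
        rw [Finset.prod_mul_distrib, ← Real.exp_sum, ← Finset.mul_sum, EuclideanSpace.norm_sq_eq]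
        simp
    _ ≤ _ := by
        gcongr
        exact mul_le_of_le_one_right (by positivity) (pow_le_one₀ (norm_nonneg _) hv)

/-- Gaussian linearization: the square in the exponent becomes a linear term averaged over g, to
which `sum_signs_exp_le` applies. -/
theorem exp_sq_div_four (s : ℝ) :
    Real.exp (s ^ 2 / 4) = ∫ g, Real.exp (√(1 / 2) * s * g) ∂gaussianReal 0 1 := by
  have h := congrFun (mgf_fun_id_gaussianReal (μ := 0) (v := 1)) (√(1 / 2) * s)
  rw [mgf] at h
  rw [h, mul_pow, Real.sq_sqrt (by norm_num)]
  congr 1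
  simp
  ring

/-- A Rademacher sum with unit coefficients is sub-Gaussian. -/
theorem sum_signs_exp_sq_le {d : ℕ} (v : EuclideanSpace ℝ (Fin d)) (hv : ‖v‖ ≤ 1) :
    ∑ ε ∈ signs d, Real.exp (⟪v, WithLp.toLp 2 ε⟫ ^ 2 / 4) ≤ 2 ^ d * 2 := by
  simp only [exp_sq_div_four]
  rw [← integral_finsetSum _ fun ε _ => integrable_exp_mul_gaussianReal _,
    integral_gaussianReal_eq_integral_smul one_ne_zero]
  have hint : Integrable fun x : ℝ => 2 ^ d * ((√(2 * Real.pi))⁻¹ * Real.exp (-(1 / 4) * x ^ 2)) :=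
    ((integrable_exp_neg_mul_sq (by norm_num)).const_mul _).const_mul _
  calc _ ≤ ∫ x : ℝ, 2 ^ d * ((√(2 * Real.pi))⁻¹ * Real.exp (-(1 / 4) * x ^ 2)) := by
        refine integral_mono_of_nonneg (ae_of_all _ fun x => ?_) hint (ae_of_all _ fun x => ?_)
        · exact mul_nonneg (gaussianPDFReal_nonneg _ _ _)
            (Finset.sum_nonneg fun ε _ => (Real.exp_pos _).le)
        · have h := sum_signs_exp_le v hv (√(1 / 2) * x)
          have h' : ∀ ε : Fin d → ℝ, √(1 / 2) * ⟪v, WithLp.toLp 2 ε⟫ * x =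
            √(1 / 2) * x * ⟪v, WithLp.toLp 2 ε⟫ := fun ε => by ring
          simp only [h', smul_eq_mul]
          refine (mul_le_mul_of_nonneg_left h (gaussianPDFReal_nonneg _ _ _)).trans (le_of_eq ?_)
          rw [gaussianPDFReal_def, mul_pow, Real.sq_sqrt (by norm_num), mul_left_comm, mul_assoc,
            ← Real.exp_add]
          simp only [NNReal.coe_one, mul_one, sub_zero]
          congr 4
          ring
    _ = 2 ^ d * √2 := by
        rw [integral_const_mul, integral_const_mul, integral_gaussian, inv_mul_eq_div,
          ← Real.sqrt_div' _ (by positivity)]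
        congr 2
        field_simp
        norm_num
    _ ≤ 2 ^ d * 2 := by
        gcongr
        exact Real.sqrt_le_iff.mpr ⟨by norm_num, by norm_num⟩

theorem norm_sq_of_mem_signs {d : ℕ} {ε : Fin d → ℝ} (hε : ε ∈ signs d) :
    ‖(WithLp.toLp 2 ε : EuclideanSpace ℝ (Fin d))‖ ^ 2 = d := by
  simp [EuclideanSpace.norm_sq_eq, sq_of_mem_signs hε]

namespace Grassmannian

variable {k d : ℕ}

/-- Jensen over the k basis vectors of V reduces to one Rademacher sum; no independence between
these sums is needed, which costs the factor k in the exponent. -/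
theorem sum_signs_exp_form_le (hk : 1 ≤ k) (V : Grassmannian k d) :
    ∑ ε ∈ signs d, Real.exp (V.form (WithLp.toLp 2 ε) (WithLp.toLp 2 ε) / (4 * k)) ≤
      2 ^ d * 2 := by
  obtain ⟨v, hv, h⟩ := V.exists_form_eq_sum
  have hk0 : (k : ℝ) ≠ 0 := by positivity
  have hexp : ∀ ε : Fin d → ℝ,
      Real.exp (V.form (WithLp.toLp 2 ε) (WithLp.toLp 2 ε) / (4 * k)) ≤
        ∑ l, (k : ℝ)⁻¹ * Real.exp (⟪v l, WithLp.toLp 2 ε⟫ ^ 2 / 4) := by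
    intro ε
    have := convexOn_exp.map_sum_le (t := Finset.univ) (w := fun _ : Fin k => (k : ℝ)⁻¹)
      (p := fun l => ⟪v l, WithLp.toLp 2 ε⟫ ^ 2 / 4) (fun _ _ => by positivity)
      (by simp [hk0]) (fun _ _ => Set.mem_univ _)
    simp only [smul_eq_mul] at this
    refine le_trans (le_of_eq ?_) this
    rw [h, Finset.sum_div]
    congr 1
    refine Finset.sum_congr rfl fun l _ => ?_
    field_simp
  calc _ ≤ ∑ ε ∈ signs d, ∑ l, (k : ℝ)⁻¹ * Real.exp (⟪v l, WithLp.toLp 2 ε⟫ ^ 2 / 4) :=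
        Finset.sum_le_sum fun ε _ => hexp ε
    _ = ∑ l, (k : ℝ)⁻¹ * ∑ ε ∈ signs d, Real.exp (⟪v l, WithLp.toLp 2 ε⟫ ^ 2 / 4) := by
        rw [Finset.sum_comm]
        simp only [Finset.mul_sum]
    _ ≤ ∑ l : Fin k, (k : ℝ)⁻¹ * (2 ^ d * 2) := by
        gcongr with l
        exact sum_signs_exp_sq_le _ (hv l).le
    _ = 2 ^ d * 2 := by
        simp [hk0]

theorem integrable_exp_form (h : k ≤ d) (x : EuclideanSpace ℝ (Fin d)) (c : ℝ) (hc : 0 ≤ c) :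
    Integrable (fun V : Grassmannian k d => Real.exp (c * V.form x x)) (sigma k d h) := by
  refine Integrable.of_bound (C := Real.exp (c * ‖x‖ ^ 2))
    (by fun_prop) (ae_of_all _ fun V => ?_)
  rw [Real.norm_of_nonneg (Real.exp_pos _).le]
  exact Real.exp_le_exp.mpr (mul_le_mul_of_nonneg_left (V.form_self_le x) hc)

/-- The normalized energy of a random projection has an exponential moment that is bounded
independently of the dimensions. -/
theorem integral_exp_form_le (hk : 1 ≤ k) (h : k ≤ d) (x : EuclideanSpace ℝ (Fin d))
    (hx : ‖x‖ ≤ 1) :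
    ∫ V, Real.exp (1 / 4 * ((d : ℝ) / k * V.form x x)) ∂sigma k d h ≤ 2 := by
  have hk0 : (0 : ℝ) < k := by positivity
  -- A sign vector e has norm √d, so a reflection carries √d x to ‖x‖ e without changing the law of
  -- the form.
  have hε : ∀ ε ∈ signs d, ∫ V, Real.exp (1 / 4 * ((d : ℝ) / k * V.form x x)) ∂sigma k d h ≤
      ∫ V, Real.exp (V.form (WithLp.toLp 2 ε) (WithLp.toLp 2 ε) / (4 * k)) ∂sigma k d h := by
    intro ε hε
    set e : EuclideanSpace ℝ (Fin d) := WithLp.toLp 2 ε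
    have he : ‖e‖ = √d := by
      rw [← norm_sq_of_mem_signs hε, Real.sqrt_sq (norm_nonneg _)]
    have hn : ‖√(d : ℝ) • x‖ = ‖‖x‖ • e‖ := by
      rw [norm_smul, norm_smul, norm_norm, he, Real.norm_of_nonneg (Real.sqrt_nonneg _), mul_comm]
    have hR := Submodule.reflection_sub hn
    have hinv := integral_form_isometry h (ℝ ∙ (√(d : ℝ) • x - ‖x‖ • e))ᗮ.reflection
      (fun _ : Unit => √(d : ℝ) • x) (fun _ => √(d : ℝ) • x)
      (fun u => Real.exp (u () / (4 * k))) (by fun_prop)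
    rw [hR] at hinv
    calc ∫ V, Real.exp (1 / 4 * ((d : ℝ) / k * V.form x x)) ∂sigma k d h
        = ∫ V, Real.exp (V.form (√(d : ℝ) • x) (√(d : ℝ) • x) / (4 * k)) ∂sigma k d h := by
          refine integral_congr_ae (ae_of_all _ fun V => ?_)
          simp only [form_smul_left, form_smul_right]
          rw [← mul_assoc √(d : ℝ), Real.mul_self_sqrt (by positivity)]
          congr 1
          field_simp
      _ = ∫ V, Real.exp (V.form (‖x‖ • e) (‖x‖ • e) / (4 * k)) ∂sigma k d h := hinv.symm
      _ ≤ _ := by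
          have hi : ∀ y : EuclideanSpace ℝ (Fin d), Integrable (fun V : Grassmannian k d =>
              Real.exp (V.form y y / (4 * k))) (sigma k d h) := fun y => by
            simp only [div_eq_inv_mul]
            exact integrable_exp_form h y _ (by positivity)
          refine integral_mono (hi _) (hi _) fun V => ?_
          simp only [form_smul_left, form_smul_right]
          rw [← mul_assoc, ← sq]
          gcongr
          exact mul_le_of_le_one_left (V.form_self_nonneg e) (pow_le_one₀ (norm_nonneg _) hx)
  -- Averaging over ε and exchanging sum and integral moves the randomness from V to ε: the bound
  -- then holds for each fixed V.
  have hsum := Finset.sum_le_sum hε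
  have hi : ∀ y : EuclideanSpace ℝ (Fin d), Integrable (fun V : Grassmannian k d =>
      Real.exp (V.form y y / (4 * k))) (sigma k d h) := fun y => by
    simp only [div_eq_inv_mul]
    exact integrable_exp_form h y _ (by positivity)
  rw [Finset.sum_const, card_signs, nsmul_eq_mul, ← integral_finsetSum _ fun ε _ => hi _] at hsum
  have h2 : ∫ V, ∑ ε ∈ signs d, Real.exp (V.form (WithLp.toLp 2 ε) (WithLp.toLp 2 ε) / (4 * k))
      ∂sigma k d h ≤ ∫ _, (2 : ℝ) ^ d * 2 ∂sigma k d h :=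
    integral_mono (integrable_finsetSum _ fun ε _ => hi _) (integrable_const _)
      fun V => V.sum_signs_exp_form_le hk
  rw [integral_const, probReal_univ, one_smul] at h2
  push_cast at hsum
  exact le_of_mul_le_mul_left (hsum.trans h2) (by positivity)

end Grassmannian

/-! ### Negative exponential moments from second and fourth moments. -/

/-- Invert 1 + a + a²/2 ≤ exp a, using (1 + a²/2)² - a² = 1 + a⁴/4 ≥ 1. -/
theorem exp_neg_le_quadratic {a : ℝ} (ha : 0 ≤ a) : Real.exp (-a) ≤ 1 - a + a ^ 2 / 2 := by
  have h := Real.quadratic_le_exp_of_nonneg ha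
  rw [Real.exp_neg]
  refine inv_le_of_inv_le₀ (by nlinarith [sq_nonneg (a - 1)]) (le_trans ?_ h)
  rw [inv_le_comm₀ (by nlinarith [sq_nonneg (a - 1)]) (by positivity),
    inv_le_iff_one_le_mul₀ (by positivity)]
  nlinarith [sq_nonneg (a ^ 2)]

/-- If the second moment of `Y` is bounded below and its fourth moment is bounded above, then the
negative exponential moments of `|Y|` are strictly less than one, with room to spare. -/
theorem exists_exp_neg_abs_le {v M : ℝ} (hv : 0 < v) (hM : 0 < M) :
    ∃ s u κ : ℝ, 0 < s ∧ 0 < u ∧ 0 < κ ∧ ∀ {G : Type} [MeasurableSpace G] (σ : Measure G)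
      [IsProbabilityMeasure σ] (Y : G → ℝ), Measurable Y →
      Integrable (fun x => Y x ^ 2) σ → Integrable (fun x => Y x ^ 4) σ →
      v ≤ ∫ x, Y x ^ 2 ∂σ → ∫ x, Y x ^ 4 ∂σ ≤ M →
      Real.exp (s * u) * ∫ x, Real.exp (-(s * |Y x|)) ∂σ ≤ Real.exp (-κ) := by
  -- This L makes M/L³ half of v/L, so m = v/L - M/L³ is a lower bound for E|Y|.
  obtain ⟨L, hL, hL2⟩ : ∃ L : ℝ, 0 < L ∧ L ^ 2 = 2 * M / v :=
    ⟨√(2 * M / v), by positivity, Real.sq_sqrt (by positivity)⟩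
  set m := v / (2 * L) with hm
  have hm0 : 0 < m := by positivity
  have hm' : v / L - M / L ^ 3 = m := by
    rw [hm, pow_succ, hL2]
    field_simp
    ring
  -- The minimizer of -sm + s²(1 + M)/2, with minimum -m²/(2(1 + M)); the choice u = m/4 spends half
  -- of it and leaves κ.
  set s := m / (1 + M) with hs
  have hs0 : 0 < s := by positivity
  refine ⟨s, m / 4, m ^ 2 / (4 * (1 + M)), hs0, by positivity, by positivity, ?_⟩
  intro G _ σ _ Y hY h2 h4 hv2 hM4
  have hpt : ∀ y : ℝ, Real.exp (-(s * |y|)) ≤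
      1 - s / L * y ^ 2 + s / L ^ 3 * y ^ 4 + s ^ 2 / 2 * (1 + y ^ 4) := by
    intro y
    have h1 := exp_neg_le_quadratic (mul_nonneg hs0.le (abs_nonneg y))
    -- For |y| ≤ L the first term alone is at most |y|; for |y| ≥ L the left side is nonpositive.
    have h2 : y ^ 2 / L - y ^ 4 / L ^ 3 ≤ |y| := by
      have hy := abs_nonneg y
      rw [← sq_abs y, show y ^ 4 = |y| ^ 4 from (Even.pow_abs (by decide) y).symm]
      set a := |y|
      rcases le_total a L with h | h
      · have : a ^ 2 / L ≤ a := by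
          rw [div_le_iff₀ hL]
          nlinarith
        have : 0 ≤ a ^ 4 / L ^ 3 := by positivity
        linarith
      · have : a ^ 2 / L ≤ a ^ 4 / L ^ 3 := by
          rw [div_le_div_iff₀ hL (by positivity)]
          have : L ^ 2 ≤ a ^ 2 := by gcongr
          nlinarith [mul_le_mul_of_nonneg_left this (by positivity : 0 ≤ a ^ 2 * L)]
        linarith
    have h3 : (s * |y|) ^ 2 / 2 ≤ s ^ 2 / 2 * (1 + y ^ 4) := by
      rw [mul_pow, sq_abs]
      nlinarith [mul_nonneg (sq_nonneg s) (sq_nonneg (y ^ 2 - 1)),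
        mul_nonneg (sq_nonneg s) (sq_nonneg (y ^ 2)), sq_nonneg s]
    have h4 := mul_le_mul_of_nonneg_left h2 hs0.le
    have h5 : s * (y ^ 2 / L - y ^ 4 / L ^ 3) = s / L * y ^ 2 - s / L ^ 3 * y ^ 4 := by ring
    linarith
  have hbound : ∫ x, Real.exp (-(s * |Y x|)) ∂σ ≤ Real.exp (-(m ^ 2 / (2 * (1 + M)))) := by
    have e1 : ∀ x, 1 - s / L * Y x ^ 2 + s / L ^ 3 * Y x ^ 4 + s ^ 2 / 2 * (1 + Y x ^ 4) =
        (1 + s ^ 2 / 2) + ((-(s / L)) * Y x ^ 2 + (s / L ^ 3 + s ^ 2 / 2) * Y x ^ 4) :=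
      fun x => by ring
    have i2 := h2.const_mul (-(s / L))
    have i4 := h4.const_mul (s / L ^ 3 + s ^ 2 / 2)
    have i24 : Integrable (fun x => (-(s / L)) * Y x ^ 2 + (s / L ^ 3 + s ^ 2 / 2) * Y x ^ 4) σ :=
      i2.add i4
    calc _ ≤ ∫ x, (1 + s ^ 2 / 2) +
          ((-(s / L)) * Y x ^ 2 + (s / L ^ 3 + s ^ 2 / 2) * Y x ^ 4) ∂σ := by
          refine integral_mono_of_nonneg (ae_of_all _ fun x => (Real.exp_pos _).le)
            ((integrable_const _).add i24) (ae_of_all _ fun x => ?_)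
          exact (hpt (Y x)).trans (e1 x).le
      _ = (1 + s ^ 2 / 2) + (-(s / L) * (∫ x, Y x ^ 2 ∂σ) +
          (s / L ^ 3 + s ^ 2 / 2) * ∫ x, Y x ^ 4 ∂σ) := by
          rw [integral_add (integrable_const _) i24, integral_add i2 i4, integral_const_mul,
            integral_const_mul, integral_const, probReal_univ, one_smul]
      _ ≤ (1 + s ^ 2 / 2) + (-(s / L) * v + (s / L ^ 3 + s ^ 2 / 2) * M) := by
          have a1 : s / L * v ≤ s / L * ∫ x, Y x ^ 2 ∂σ := by gcongr
          have a2 : (s / L ^ 3 + s ^ 2 / 2) * ∫ x, Y x ^ 4 ∂σ ≤ (s / L ^ 3 + s ^ 2 / 2) * M := by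
            gcongr
          linarith
      _ = -(m ^ 2 / (2 * (1 + M))) + 1 := by
          have : (1 + s ^ 2 / 2) + (-(s / L) * v + (s / L ^ 3 + s ^ 2 / 2) * M) =
            1 - s * (v / L - M / L ^ 3) + s ^ 2 / 2 * (1 + M) := by ring
          rw [this, hm', hs]
          field_simp
          ring
      _ ≤ _ := Real.add_one_le_exp _
  calc _ ≤ Real.exp (s * (m / 4)) * Real.exp (-(m ^ 2 / (2 * (1 + M)))) := by gcongr
    _ = _ := by
      rw [← Real.exp_add, hs]
      congr 1
      field_simp
      ring

/-! ### Tail bounds for a fixed matrix and a fixed vector. -/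

namespace Grassmannian

variable {k d : ℕ}

/-- The normalized measurement of `x xᵀ + t y yᵀ`. -/
noncomputable def pairing (V : Grassmannian k d) (x y : EuclideanSpace ℝ (Fin d)) (t : ℝ) : ℝ :=
  (d : ℝ) / k * (V.form x x + t * V.form y y)

@[fun_prop]
theorem measurable_pairing (x y : EuclideanSpace ℝ (Fin d)) (t : ℝ) :
    Measurable fun V : Grassmannian k d => V.pairing x y t := by
  unfold pairing
  fun_prop

theorem integrable_pairing_pow (h : k ≤ d) (x y : EuclideanSpace ℝ (Fin d)) (t : ℝ) (p : ℕ) :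
    Integrable (fun V : Grassmannian k d => V.pairing x y t ^ p) (sigma k d h) := by
  refine Integrable.of_bound (C := ((d : ℝ) / k * (‖x‖ * ‖x‖ + |t| * (‖y‖ * ‖y‖))) ^ p)
    (by fun_prop) (ae_of_all _ fun V => ?_)
  rw [norm_pow, Real.norm_eq_abs, pairing, abs_mul, abs_of_nonneg (by positivity : 0 ≤ (d : ℝ) / k)]
  gcongr
  refine (abs_add_le _ _).trans ?_
  rw [abs_mul]
  gcongr <;> exact V.abs_form_le _ _

/-- From z⁴ ≤ 4! · 4⁴ exp(z/4) = 6144 exp(z/4) and (a + b)⁴ ≤ 8(a⁴ + b⁴). -/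
theorem pairing_pow_four_le (V : Grassmannian k d) {x y : EuclideanSpace ℝ (Fin d)} {t : ℝ}
    (ht : |t| ≤ 1) : V.pairing x y t ^ 4 ≤
      49152 * (Real.exp (1 / 4 * ((d : ℝ) / k * V.form x x)) +
        Real.exp (1 / 4 * ((d : ℝ) / k * V.form y y))) := by
  have hp : ∀ z : EuclideanSpace ℝ (Fin d), 0 ≤ (d : ℝ) / k * V.form z z := fun z =>
    mul_nonneg (by positivity) (V.form_self_nonneg z)
  have hexp : ∀ z : EuclideanSpace ℝ (Fin d), ((d : ℝ) / k * V.form z z) ^ 4 ≤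
      6144 * Real.exp (1 / 4 * ((d : ℝ) / k * V.form z z)) := by
    intro z
    have := Real.pow_div_factorial_le_exp _ (mul_nonneg (by norm_num : (0 : ℝ) ≤ 1 / 4) (hp z)) 4
    rw [div_le_iff₀ (by positivity), mul_pow, show (Nat.factorial 4 : ℝ) = 24 by
      norm_num [Nat.factorial]] at this
    linarith
  have h1 : |V.pairing x y t| ≤ (d : ℝ) / k * V.form x x + (d : ℝ) / k * V.form y y := by
    rw [pairing, mul_add]
    refine (abs_add_le _ _).trans ?_
    rw [abs_of_nonneg (hp x), mul_left_comm, abs_mul, abs_of_nonneg (hp y)]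
    exact add_le_add_right (mul_le_of_le_one_left (hp y) ht) _
  have h2 : V.pairing x y t ^ 4 ≤
      ((d : ℝ) / k * V.form x x + (d : ℝ) / k * V.form y y) ^ 4 := by
    rw [← Even.pow_abs (by decide : Even 4)]
    gcongr
  have h3 := add_pow_le (hp x) (hp y) 4
  have h4 := hexp x
  have h5 := hexp y
  norm_num at h3
  linarith

theorem integral_pairing_pow_four_le (hk : 1 ≤ k) (h : k ≤ d) {x y : EuclideanSpace ℝ (Fin d)}
    (hx : ‖x‖ ≤ 1) (hy : ‖y‖ ≤ 1) {t : ℝ} (ht : |t| ≤ 1) :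
    ∫ V, V.pairing x y t ^ 4 ∂sigma k d h ≤ 196608 := by
  have hi : ∀ z : EuclideanSpace ℝ (Fin d), Integrable (fun V : Grassmannian k d =>
      Real.exp (1 / 4 * ((d : ℝ) / k * V.form z z))) (sigma k d h) := fun z => by
    simp only [← mul_assoc]
    exact integrable_exp_form h z _ (by positivity)
  have h1 := integral_mono (integrable_pairing_pow h x y t 4) (((hi x).add (hi y)).const_mul 49152)
    fun V => V.pairing_pow_four_le ht
  simp only [Pi.add_apply] at h1
  rw [integral_const_mul, integral_add (hi x) (hi y)] at h1
  have := integral_exp_form_le hk h x hx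
  have := integral_exp_form_le hk h y hy
  linarith

/-- The lower tail of the normalized `ℓ¹` norm of the measurements of a fixed matrix. -/
theorem exists_lower_tail (k : ℕ) (hk : 1 ≤ k) :
    ∃ u κ : ℝ, 0 < u ∧ 0 < κ ∧ ∀ (d : ℕ) (hkd : k < d) (n : ℕ) {Ω : Type*} [MeasurableSpace Ω]
      (P : Measure Ω) (V : Fin n → Ω → Grassmannian k d), iIndepFun V P →
      (∀ j, HasLaw (V j) (sigma k d hkd.le) P) →
      ∀ (x y : EuclideanSpace ℝ (Fin d)) (t : ℝ), ‖x‖ = 1 → ‖y‖ = 1 → ⟪x, y⟫ = 0 → |t| ≤ 1 →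
      P.real {ω | ∑ j, |(V j ω).pairing x y t| ≤ n * u} ≤ Real.exp (-(κ * n)) := by
  have hk0 : (0 : ℝ) < k := by positivity
  obtain ⟨s, u, κ, hs, hu, hκ, H⟩ :=
    exists_exp_neg_abs_le (v := 1 / (k : ℝ) ^ 2) (M := 196608) (by positivity) (by norm_num)
  refine ⟨u, κ, hu, hκ, ?_⟩
  intro d hkd n Ω _ P V hind hlaw x y t hx hy hxy ht
  have h1 := H (sigma k d hkd.le) (fun V => V.pairing x y t) (by fun_prop)
    (integrable_pairing_pow _ _ _ _ _) (integrable_pairing_pow _ _ _ _ _)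
    (le_second_moment hk hkd hx hy hxy t) (integral_pairing_pow_four_le hk _ hx.le hy.le ht)
  have h2 := measureReal_le_of_iid hind hlaw (f := fun V => -(s * |V.pairing x y t|))
    (by fun_prop) (M := 0) (fun V => by
      have := mul_nonneg hs.le (abs_nonneg (V.pairing x y t))
      linarith) (-(s * u))
  have hset : {ω | ∑ j, |(V j ω).pairing x y t| ≤ n * u} =
      {ω | (n : ℝ) * -(s * u) ≤ ∑ j, -(s * |(V j ω).pairing x y t|)} := by
    ext ω
    simp only [Set.mem_ofPred_eq, Finset.sum_neg_distrib, ← Finset.mul_sum]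
    rw [mul_neg, neg_le_neg_iff, mul_left_comm, mul_le_mul_iff_right₀ hs]
  rw [hset]
  refine h2.trans ?_
  rw [neg_neg]
  calc _ ≤ Real.exp (-κ) ^ n := by
        gcongr
    _ = _ := by
        rw [← Real.exp_nat_mul]
        ring_nf

/-- The upper tail of the normalized energy of the projections of a fixed vector. -/
theorem upper_tail (hk : 1 ≤ k) (hkd : k ≤ d) {n : ℕ} {Ω : Type*} [MeasurableSpace Ω]
    (P : Measure Ω) (V : Fin n → Ω → Grassmannian k d) (hind : iIndepFun V P)
    (hlaw : ∀ j, HasLaw (V j) (sigma k d hkd) P) (x : EuclideanSpace ℝ (Fin d)) (hx : ‖x‖ ≤ 1)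
    (a : ℝ) :
    P.real {ω | n * (4 * a) ≤ ∑ j, (d : ℝ) / k * (V j ω).form x x} ≤
      (Real.exp (-a) * 2) ^ n := by
  have h2 := measureReal_le_of_iid hind hlaw (f := fun V => 1 / 4 * ((d : ℝ) / k * V.form x x))
    (by fun_prop) (M := 1 / 4 * ((d : ℝ) / k * ‖x‖ ^ 2)) (fun V => by
      gcongr
      exact V.form_self_le x) a
  have hset : {ω | n * (4 * a) ≤ ∑ j, (d : ℝ) / k * (V j ω).form x x} =
      {ω | (n : ℝ) * a ≤ ∑ j, 1 / 4 * ((d : ℝ) / k * (V j ω).form x x)} := by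
    ext ω
    simp only [Set.mem_ofPred_eq]
    simp only [← Finset.mul_sum]
    constructor <;> intro h <;> linarith
  rw [hset]
  refine h2.trans ?_
  gcongr
  exact integral_exp_form_le hk hkd x hx

end Grassmannian

/-! ### Energy and perturbation estimates. -/

/-- The centres of a net can be moved into the set at the cost of doubling the radius. -/
theorem exists_net_subset {X : Type*} [PseudoMetricSpace X] (A : Set X) (s : Finset X) (ε : ℝ)
    (h : ∀ x ∈ A, ∃ y ∈ s, dist x y ≤ ε) :
    ∃ t : Finset X, t.card ≤ s.card ∧ (∀ x ∈ t, x ∈ A) ∧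
      ∀ x ∈ A, ∃ y ∈ t, dist x y ≤ 2 * ε := by
  classical
  let p : X → Prop := fun y => ∃ x ∈ A, dist x y ≤ ε
  -- The default value y is never used: only centres satisfying `p` are kept.
  let f : X → X := fun y => if hy : p y then hy.choose else y
  have hf : ∀ y, p y → f y ∈ A ∧ dist (f y) y ≤ ε := fun y hy => by
    simp only [f, hy, dite_true]
    exact hy.choose_spec
  refine ⟨(s.filter p).image f, Finset.card_image_le.trans (Finset.card_filter_le _ _), ?_, ?_⟩
  · intro x hx
    obtain ⟨y, hy, rfl⟩ := Finset.mem_image.mp hx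
    exact (hf y (Finset.mem_filter.mp hy).2).1
  · intro x hx
    obtain ⟨y, hy, hxy⟩ := h x hx
    have hp : p y := ⟨x, hx, hxy⟩
    refine ⟨f y, Finset.mem_image_of_mem f (Finset.mem_filter.mpr ⟨hy, hp⟩), ?_⟩
    have := dist_triangle_right x (f y) y
    linarith [(hf y hp).2]

namespace Grassmannian

variable {k d n : ℕ}

/-- The normalized energy `(d / k) ∑ⱼ ‖P_{V_j} x‖²`. -/
noncomputable def energy (V : Fin n → Grassmannian k d) (x : EuclideanSpace ℝ (Fin d)) : ℝ :=
  ∑ j, (d : ℝ) / k * (V j).form x x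

theorem energy_smul (V : Fin n → Grassmannian k d) (a : ℝ) (x : EuclideanSpace ℝ (Fin d)) :
    energy V (a • x) = a ^ 2 * energy V x := by
  simp only [energy, form_smul_left, form_smul_right, Finset.mul_sum]
  exact Finset.sum_congr rfl fun j _ => by ring

theorem energy_add_le (V : Fin n → Grassmannian k d) (x y : EuclideanSpace ℝ (Fin d)) :
    energy V (x + y) ≤ 2 * energy V x + 2 * energy V y := by
  simp only [energy, Finset.mul_sum, ← Finset.sum_add_distrib]
  refine Finset.sum_le_sum fun j _ => ?_
  have h := (V j).form_self_nonneg (x - y)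
  have hk : (0 : ℝ) ≤ d / k := by positivity
  have : (V j).form (x + y) (x + y) ≤ 2 * (V j).form x x + 2 * (V j).form y y := by
    simp only [form_add_left, form_sub_left, form_add_right, form_sub_right] at h ⊢
    linarith
  have := mul_le_mul_of_nonneg_left this hk
  linarith

theorem energy_le_of_norm_le (V : Fin n → Grassmannian k d) {Q : ℝ}
    (hQ : ∀ x, ‖x‖ ≤ 1 → energy V x ≤ Q) {x : EuclideanSpace ℝ (Fin d)} {r : ℝ} (hr : 0 < r)
    (hx : ‖x‖ ≤ r) : energy V x ≤ r ^ 2 * Q := by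
  have h1 : x = r • (r⁻¹ • x) := by rw [smul_smul, mul_inv_cancel₀ hr.ne', one_smul]
  rw [h1, energy_smul]
  refine mul_le_mul_of_nonneg_left (hQ _ ?_) (sq_nonneg r)
  rw [norm_smul, norm_inv, Real.norm_of_nonneg hr.le, inv_mul_le_iff₀ hr, mul_one]
  exact hx

/-- The energy on the unit ball is controlled by the energy on a `1/2`-net. -/
theorem energy_le_of_net (V : Fin n → Grassmannian k d) (s : Finset (EuclideanSpace ℝ (Fin d)))
    (hs : ∀ x : EuclideanSpace ℝ (Fin d), ‖x‖ ≤ 1 → ∃ y ∈ s, ‖x - y‖ ≤ 1 / 2) {Q : ℝ}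
    (hQ : ∀ y ∈ s, energy V y ≤ Q) (x : EuclideanSpace ℝ (Fin d)) (hx : ‖x‖ ≤ 1) :
    energy V x ≤ 4 * Q := by
  have hcont : Continuous (energy V) := by
    unfold energy form
    fun_prop
  -- At a maximizer x₀ with net point y, energy(x₀) ≤ 2Q + 2 · (1/4) energy(x₀), which can be solved
  -- for energy(x₀).
  obtain ⟨x₀, hx₀, hmax⟩ := (isCompact_closedBall (0 : EuclideanSpace ℝ (Fin d)) 1).exists_isMaxOn
    ⟨0, by simp⟩ hcont.continuousOn
  have hmax' : ∀ z, ‖z‖ ≤ 1 → energy V z ≤ energy V x₀ := fun z hz =>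
    hmax (mem_closedBall_zero_iff.mpr hz)
  obtain ⟨y, hy, hxy⟩ := hs x₀ (mem_closedBall_zero_iff.mp hx₀)
  have h1 := energy_add_le V y (x₀ - y)
  have h2 := energy_le_of_norm_le V hmax' (by norm_num) hxy
  have h3 := hQ y hy
  have h4 := hmax' x hx
  rw [add_sub_cancel] at h1
  linarith

/-- Perturbation of the `ℓ¹` norm of a quadratic measurement. -/
theorem sum_abs_form_sub_le (V : Fin n → Grassmannian k d) {Q : ℝ}
    (hQ : ∀ x, ‖x‖ ≤ 1 → energy V x ≤ Q) {x y : EuclideanSpace ℝ (Fin d)} (hx : ‖x‖ ≤ 1)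
    (hy : ‖y‖ ≤ 1) {δ : ℝ} (hδ : 0 < δ) (hxy : ‖x - y‖ ≤ δ) :
    ∑ j, (d : ℝ) / k * |(V j).form x x - (V j).form y y| ≤ 5 / 2 * δ * Q := by
  -- Polarization into form(x - y, x + y), then AM–GM with weight δ, so that both terms become
  -- O(δQ): δQ and 4δQ, halved.
  have h1 : ∀ j, (d : ℝ) / k * |(V j).form x x - (V j).form y y| ≤
      1 / 2 * (δ⁻¹ * ((d : ℝ) / k * (V j).form (x - y) (x - y)) +
        δ * ((d : ℝ) / k * (V j).form (x + y) (x + y))) := by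
    intro j
    have hk : (0 : ℝ) ≤ d / k := by positivity
    have e : (V j).form x x - (V j).form y y = (V j).form (x - y) (x + y) := by
      rw [form_sub_left, form_add_right, form_add_right, form_comm _ y x]
      ring
    have p1 := (V j).form_self_nonneg (δ⁻¹ • (x - y) + (x + y))
    have p2 := (V j).form_self_nonneg (δ⁻¹ • (x - y) - (x + y))
    have h : |(V j).form (x - y) (x + y)| ≤ 1 / 2 * (δ⁻¹ * (V j).form (x - y) (x - y) +
        δ * (V j).form (x + y) (x + y)) := by
      generalize x - y = u at *
      generalize x + y = w at *
      simp only [form_add_left, form_add_right, form_sub_left, form_sub_right, form_smul_left,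
        form_smul_right, form_comm (V j) w u] at p1 p2
      have q1 := mul_nonneg hδ.le p1
      have q2 := mul_nonneg hδ.le p2
      have e1 : δ * δ⁻¹ = 1 := mul_inv_cancel₀ hδ.ne'
      have r1 : δ * (δ⁻¹ * (δ⁻¹ * (V j).form u u)) = δ⁻¹ * (V j).form u u := by
        rw [← mul_assoc, e1, one_mul]
      have r2 : δ * (δ⁻¹ * (V j).form u w) = (V j).form u w := by
        rw [← mul_assoc, e1, one_mul]
      rw [abs_le]
      constructor <;> linarith
    rw [e]
    have := mul_le_mul_of_nonneg_left h hk
    linarith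
  refine (Finset.sum_le_sum fun j _ => h1 j).trans ?_
  simp only [Finset.sum_add_distrib, ← Finset.mul_sum]
  have h2 := energy_le_of_norm_le V hQ hδ hxy
  have h3 := energy_le_of_norm_le V hQ two_pos
    (show ‖x + y‖ ≤ 2 from (norm_add_le x y).trans (by linarith))
  have h4 : δ⁻¹ * energy V (x - y) ≤ δ * Q := by
    rw [inv_mul_le_iff₀ hδ]
    linarith
  have h5 : δ * energy V (x + y) ≤ δ * (2 ^ 2 * Q) := by gcongr
  simp only [energy, ← Finset.mul_sum] at h4 h5
  linarith

theorem sum_abs_pairing_ge (V : Fin n → Grassmannian k d) {Q : ℝ}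
    (hQ : ∀ x, ‖x‖ ≤ 1 → energy V x ≤ Q) {x x' z z' : EuclideanSpace ℝ (Fin d)} (hx : ‖x‖ ≤ 1)
    (hx' : ‖x'‖ ≤ 1) (hz : ‖z‖ ≤ 1) (hz' : ‖z'‖ ≤ 1) {δ : ℝ} (hδ : 0 < δ) (hxx : ‖x - x'‖ ≤ δ)
    (hzz : ‖z - z'‖ ≤ δ) {e : ℝ} (he : |e| ≤ 1) :
    ∑ j, |(V j).pairing x' z' e| - 5 * δ * Q ≤ ∑ j, |(V j).pairing x z e| := by
  have h1 := sum_abs_form_sub_le V hQ hx hx' hδ hxx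
  have h2 := sum_abs_form_sub_le V hQ hz hz' hδ hzz
  have h3 : ∑ j, |(V j).pairing x' z' e| ≤ ∑ j, (|(V j).pairing x z e| +
      ((d : ℝ) / k * |(V j).form x x - (V j).form x' x'| +
        (d : ℝ) / k * |(V j).form z z - (V j).form z' z'|)) := by
    refine Finset.sum_le_sum fun j _ => ?_
    have hk : (0 : ℝ) ≤ d / k := by positivity
    have e1 : (V j).pairing x' z' e = (V j).pairing x z e -
        ((d : ℝ) / k * ((V j).form x x - (V j).form x' x') +
          e * ((d : ℝ) / k * ((V j).form z z - (V j).form z' z'))) := by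
      unfold pairing
      ring
    rw [e1]
    refine (abs_sub _ _).trans (add_le_add_right ((abs_add_le _ _).trans ?_) _)
    rw [abs_mul, abs_mul, abs_mul, abs_of_nonneg hk]
    exact add_le_add_right (mul_le_of_le_one_left (by positivity) he) _
  rw [Finset.sum_add_distrib, Finset.sum_add_distrib] at h3
  linarith

end Grassmannian

/-! ### Spectral reduction of matrices of rank at most two. -/

theorem trace_mul_proj {k d : ℕ} (V : Grassmannian k d) (X : Matrix (Fin d) (Fin d) ℝ)
    (b : OrthonormalBasis (Fin d) ℝ (EuclideanSpace ℝ (Fin d))) (a : Fin d → ℝ)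
    (hb : ∀ i, Matrix.toEuclideanCLM (n := Fin d) (𝕜 := ℝ) X (b i) = a i • b i) :
    (X * V.proj).trace = ∑ i, a i * V.form (b i) (b i) := by
  have h1 : (X * V.proj).trace = LinearMap.trace ℝ _ (Matrix.toEuclideanLin (V.proj * X)) := by
    rw [Matrix.toEuclideanLin_eq_toLin_orthonormal, Matrix.trace_toLin_eq, Matrix.trace_mul_comm]
  rw [h1, LinearMap.trace_eq_sum_inner _ b]
  refine Finset.sum_congr rfl fun i _ => ?_
  rw [← Matrix.coe_toEuclideanCLM_eq_toEuclideanLin, map_mul]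
  have : Matrix.toEuclideanCLM (n := Fin d) (𝕜 := ℝ) V.proj = V.toSubmodule.starProjection :=
    StarAlgEquiv.apply_symm_apply _ _
  rw [this]
  simp [hb, Grassmannian.form, real_inner_smul_right]

theorem opNorm_le_of_eigenvalues {d : ℕ} (X : Matrix (Fin d) (Fin d) ℝ)
    (b : OrthonormalBasis (Fin d) ℝ (EuclideanSpace ℝ (Fin d))) (a : Fin d → ℝ)
    (hb : ∀ i, Matrix.toEuclideanCLM (n := Fin d) (𝕜 := ℝ) X (b i) = a i • b i) {M : ℝ}
    (hM : 0 ≤ M) (ha : ∀ i, |a i| ≤ M) : opNorm X ≤ M := by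
  refine ContinuousLinearMap.opNorm_le_bound _ hM fun v => ?_
  have h1 : Matrix.toEuclideanCLM (n := Fin d) (𝕜 := ℝ) X v = ∑ i, (a i * ⟪b i, v⟫) • b i := by
    conv_lhs => rw [← b.sum_repr' v]
    rw [map_sum]
    refine Finset.sum_congr rfl fun i _ => ?_
    rw [map_smul, hb, smul_smul, mul_comm]
  rw [← sq_le_sq₀ (norm_nonneg _) (by positivity), mul_pow, ← b.sum_sq_inner_right v,
    ← b.sum_sq_inner_right, h1, Finset.mul_sum]
  refine Finset.sum_le_sum fun i _ => ?_
  rw [b.orthonormal.inner_right_fintype, mul_pow]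
  exact mul_le_mul_of_nonneg_right (sq_le_sq' (abs_le.mp (ha i)).1 (abs_le.mp (ha i)).2)
    (sq_nonneg _)

/-- A symmetric matrix of rank at most two is a multiple of `x xᵀ + t y yᵀ` with orthonormal
`x`, `y` and `|t| ≤ 1`. -/
theorem exists_eq_of_rank_le_two {d : ℕ} (hd : 2 ≤ d) {X : Matrix (Fin d) (Fin d) ℝ}
    (hX : X.IsSymm) (hr : X.rank ≤ 2) :
    ∃ (a t : ℝ) (x y : EuclideanSpace ℝ (Fin d)), ‖x‖ = 1 ∧ ‖y‖ = 1 ∧ ⟪x, y⟫ = 0 ∧ |t| ≤ 1 ∧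
      opNorm X ≤ |a| ∧ ∀ {k : ℕ} (V : Grassmannian k d),
        (X * V.proj).trace = a * (V.form x x + t * V.form y y) := by
  have hH : X.IsHermitian := by
    rw [Matrix.IsHermitian, Matrix.conjTranspose_eq_transpose_of_trivial]
    exact hX
  set b := hH.eigenvectorBasis
  set l := hH.eigenvalues
  have hb : ∀ i, Matrix.toEuclideanCLM (n := Fin d) (𝕜 := ℝ) X (b i) = l i • b i := by
    intro i
    have := hH.mulVec_eigenvectorBasis i
    apply (WithLp.ofLp_injective 2)
    rw [Matrix.ofLp_toEuclideanCLM, WithLp.ofLp_smul]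
    exact this
  have : Nonempty (Fin d) := ⟨⟨0, by omega⟩⟩
  obtain ⟨i, -, hi⟩ := Finset.univ.exists_max_image (fun i => |l i|) Finset.univ_nonempty
  have hmax : ∀ j, |l j| ≤ |l i| := fun j => hi j (Finset.mem_univ j)
  -- Take j to be a second nonzero eigenvalue's index if there is one, any other index otherwise; a
  -- third nonzero eigenvalue would contradict the rank.
  obtain ⟨j, hji, hj⟩ : ∃ j, j ≠ i ∧ ∀ m, m ≠ i → m ≠ j → l m = 0 := by
    by_cases h0 : ∃ j, j ≠ i ∧ l j ≠ 0
    · obtain ⟨j, hji, hj⟩ := h0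
      refine ⟨j, hji, fun m hmi hmj => ?_⟩
      by_contra hm
      have hli : l i ≠ 0 := fun h => hj (by simpa [h] using hmax j)
      rw [hH.rank_eq_card_non_zero_eigs, Fintype.card_subtype] at hr
      have hsub : ({i, j, m} : Finset (Fin d)) ⊆ Finset.univ.filter fun i => l i ≠ 0 := by
        intro p hp
        simp only [Finset.mem_insert, Finset.mem_singleton] at hp
        rcases hp with rfl | rfl | rfl <;> simp [*]
      have := Finset.card_le_card hsub
      rw [Finset.card_eq_three.mpr ⟨i, j, m, hji.symm, hmi.symm, hmj.symm, rfl⟩] at this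
      exact absurd (this.trans hr) (by norm_num)
    · push Not at h0
      obtain ⟨j, hj⟩ : ∃ j : Fin d, j ≠ i :=
        have : Nontrivial (Fin d) := Fin.nontrivial_iff_two_le.mpr hd
        exists_ne i
      exact ⟨j, hj, fun m hm _ => h0 m hm⟩
  -- If the largest eigenvalue is 0 then X = 0, and division by zero gives t = 0, which is harmless.
  refine ⟨l i, l j / l i, b i, b j, b.orthonormal.1 i, b.orthonormal.1 j,
    b.orthonormal.2 hji.symm, ?_, opNorm_le_of_eigenvalues X b l hb (abs_nonneg _) hmax, ?_⟩
  · rw [abs_div]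
    exact div_le_one_of_le₀ (hmax j) (abs_nonneg _)
  · intro k V
    rw [trace_mul_proj V X b l hb, ← Finset.sum_subset (Finset.subset_univ {i, j}),
      Finset.sum_pair hji.symm]
    · rcases eq_or_ne (l i) 0 with h | h
      · have : l j = 0 := by simpa [h] using hmax j
        simp [h, this]
      · field_simp
    · intro m _ hm
      simp only [Finset.mem_insert, Finset.mem_singleton, not_or] at hm
      rw [hj m hm.1 hm.2, zero_mul]

/-! ### Nets of orthogonal pairs and the union bound. -/

theorem exists_ball_net (d m : ℕ) :
    ∃ s : Finset (EuclideanSpace ℝ (Fin d)), s.card ≤ (5 ^ (m + 1)) ^ d ∧ (∀ y ∈ s, ‖y‖ ≤ 1) ∧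
      ∀ x : EuclideanSpace ℝ (Fin d), ‖x‖ ≤ 1 → ∃ y ∈ s, ‖x - y‖ ≤ (1 / 2) ^ m := by
  obtain ⟨s, hs, hnet⟩ := exists_net (EuclideanSpace ℝ (Fin d)) (m + 1)
  obtain ⟨t, ht, htA, htnet⟩ := exists_net_subset {x | ‖x‖ ≤ 1} s ((1 / 2) ^ (m + 1))
    fun x hx => by simpa only [dist_eq_norm] using hnet x hx
  refine ⟨t, ht.trans (by simpa using hs), htA, fun x hx => ?_⟩
  obtain ⟨y, hy, hxy⟩ := htnet x hx
  refine ⟨y, hy, ?_⟩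
  rw [← dist_eq_norm]
  exact hxy.trans (le_of_eq (by ring))

/-- The pairs `(x, c y)` with `x`, `y` orthonormal and `0 ≤ c ≤ 1`. -/
def orthogonalPairs (d : ℕ) : Set (EuclideanSpace ℝ (Fin d) × EuclideanSpace ℝ (Fin d)) :=
  {p | ∃ y : EuclideanSpace ℝ (Fin d), ∃ c : ℝ, ‖p.1‖ = 1 ∧ ‖y‖ = 1 ∧ ⟪p.1, y⟫ = 0 ∧
    0 ≤ c ∧ c ≤ 1 ∧ p.2 = c • y}

theorem norm_snd_le_of_mem_orthogonalPairs {d : ℕ}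
    {p : EuclideanSpace ℝ (Fin d) × EuclideanSpace ℝ (Fin d)} (hp : p ∈ orthogonalPairs d) :
    ‖p.2‖ ≤ 1 := by
  obtain ⟨y, c, -, hy, -, hc, hc', h⟩ := hp
  rw [h, norm_smul, hy, mul_one, Real.norm_of_nonneg hc]
  exact hc'

/-- The net points must themselves be orthogonal pairs, since the lower tail is only available for
those. -/
theorem exists_pair_net (d m : ℕ) :
    ∃ s : Finset (EuclideanSpace ℝ (Fin d) × EuclideanSpace ℝ (Fin d)),
      s.card ≤ (25 ^ (m + 1)) ^ d ∧ (∀ p ∈ s, p ∈ orthogonalPairs d) ∧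
      ∀ p ∈ orthogonalPairs d, ∃ q ∈ s, ‖p.1 - q.1‖ ≤ (1 / 2) ^ m ∧ ‖p.2 - q.2‖ ≤ (1 / 2) ^ m := by
  obtain ⟨s, hs, hnet⟩ := exists_net (EuclideanSpace ℝ (Fin d)) (m + 1)
  obtain ⟨t, ht, htA, htnet⟩ := exists_net_subset (orthogonalPairs d) (s ×ˢ s)
    ((1 / 2) ^ (m + 1)) fun p hp => by
      obtain ⟨y, hy, h1⟩ := hnet p.1 hp.choose_spec.choose_spec.1.le
      obtain ⟨z, hz, h2⟩ := hnet p.2 (norm_snd_le_of_mem_orthogonalPairs hp)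
      refine ⟨(y, z), Finset.mk_mem_product hy hz, ?_⟩
      rw [Prod.dist_eq, dist_eq_norm, dist_eq_norm]
      exact max_le h1 h2
  refine ⟨t, ht.trans ?_, htA, fun p hp => ?_⟩
  · rw [Finset.card_product]
    refine (Nat.mul_le_mul hs hs).trans (le_of_eq ?_)
    rw [finrank_euclideanSpace_fin, ← mul_pow, ← mul_pow]
    norm_num
  · obtain ⟨q, hq, hpq⟩ := htnet p hp
    rw [Prod.dist_eq, dist_eq_norm, dist_eq_norm] at hpq
    have h := hpq.trans (le_of_eq (by ring : 2 * (1 / 2 : ℝ) ^ (m + 1) = (1 / 2) ^ m))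
    exact ⟨q, hq, (le_max_left _ _).trans h, (le_max_right _ _).trans h⟩

namespace Grassmannian

variable {k d n : ℕ}

theorem pairing_smul (V : Grassmannian k d) (x y : EuclideanSpace ℝ (Fin d)) (c e : ℝ) :
    V.pairing x (c • y) e = V.pairing x y (e * c ^ 2) := by
  simp only [pairing, form_smul_left, form_smul_right]
  ring

/-- On the event that the energies are not too large on a net of the ball and that the measurements
of the matrices of a net are not too small, the lower bound holds for all matrices. -/
theorem lower_bound_of_nets (hd : 2 ≤ d) (V : Fin n → Grassmannian k d) {u a δ : ℝ} (hδ : 0 < δ)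
    (hδu : 80 * a * δ ≤ u / 2) (s : Finset (EuclideanSpace ℝ (Fin d)))
    (hs : ∀ x : EuclideanSpace ℝ (Fin d), ‖x‖ ≤ 1 → ∃ y ∈ s, ‖x - y‖ ≤ 1 / 2)
    (t : Finset (EuclideanSpace ℝ (Fin d) × EuclideanSpace ℝ (Fin d)))
    (ht : ∀ p ∈ t, p ∈ orthogonalPairs d)
    (htnet : ∀ p ∈ orthogonalPairs d, ∃ q ∈ t, ‖p.1 - q.1‖ ≤ δ ∧ ‖p.2 - q.2‖ ≤ δ)
    (hup : ∀ y ∈ s, energy V y < n * (4 * a))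
    (hlow : ∀ e ∈ ({1, -1} : Finset ℝ), ∀ p ∈ t, n * u < ∑ j, |(V j).pairing p.1 p.2 e|)
    (X : Matrix (Fin d) (Fin d) ℝ) (hX : X.IsSymm) (hr : X.rank ≤ 2) :
    n * (u / 2) * opNorm X ≤ l1Norm (measurement V X) := by
  have hQ : ∀ x, ‖x‖ ≤ 1 → energy V x ≤ 4 * (n * (4 * a)) :=
    energy_le_of_net V s hs fun y hy => (hup y hy).le
  obtain ⟨b, τ, x, y, hx, hy, hxy, hτ, hop, htr⟩ := exists_eq_of_rank_le_two hd hX hr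
  -- √|τ| is absorbed into the second vector, so only the sign of τ remains and no net in τ is
  -- needed.
  obtain ⟨e, c, he, hc, hc1, hec⟩ : ∃ e c : ℝ, e ∈ ({1, -1} : Finset ℝ) ∧ 0 ≤ c ∧ c ≤ 1 ∧
      e * c ^ 2 = τ := by
    rcases le_total 0 τ with h | h
    · exact ⟨1, √τ, by simp, Real.sqrt_nonneg _,
        Real.sqrt_le_one.mpr ((le_abs_self τ).trans hτ), by rw [Real.sq_sqrt h, one_mul]⟩
    · exact ⟨-1, √(-τ), by simp, Real.sqrt_nonneg _,
        Real.sqrt_le_one.mpr ((neg_le_abs τ).trans hτ),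
        by rw [Real.sq_sqrt (by linarith)]; ring⟩
  have he1 : |e| ≤ 1 := by
    rcases Finset.mem_insert.mp he with rfl | h
    · simp
    · simp [Finset.mem_singleton.mp h]
  have hp : (x, c • y) ∈ orthogonalPairs d := ⟨y, c, hx, hy, hxy, hc, hc1, rfl⟩
  obtain ⟨q, hq, hq1, hq2⟩ := htnet _ hp
  have h1 := sum_abs_pairing_ge V hQ hx.le (ht q hq).choose_spec.choose_spec.1.le
    (norm_snd_le_of_mem_orthogonalPairs hp) (norm_snd_le_of_mem_orthogonalPairs (ht q hq)) hδ
    hq1 hq2 he1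
  have h2 := hlow e he q hq
  have h3 : l1Norm (measurement V X) = |b| * ∑ j, |(V j).pairing x (c • y) e| := by
    rw [l1Norm, Finset.mul_sum]
    refine Finset.sum_congr rfl fun j _ => ?_
    rw [measurement, htr, pairing_smul, hec, pairing, ← abs_mul]
    congr 1
    ring
  -- The perturbation error is 5δ · 16na = 80aδn, at most half of nu.
  have hsum : n * (u / 2) ≤ ∑ j, |(V j).pairing x (c • y) e| := by
    have := mul_le_mul_of_nonneg_left hδu (Nat.cast_nonneg (α := ℝ) n)
    linarith
  rw [h3, mul_comm |b|]
  have h0 : 0 ≤ opNorm X := norm_nonneg _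
  exact mul_le_mul hsum hop h0 (Finset.sum_nonneg fun _ _ => abs_nonneg _)

end Grassmannian

open Grassmannian in
/-- With overwhelming probability, the normalized `ℓ¹` norm of the measurements bounds the operator
norm on the symmetric matrices of rank at most two. -/
theorem exists_uniform_lower_bound (k : ℕ) (hk : 1 ≤ k) :
    ∃ u c C : ℝ, 0 < u ∧ 0 < c ∧ 0 < C ∧ ∀ (d : ℕ) (hkd : k < d) (n : ℕ), c * (d : ℝ) ≤ (n : ℝ) →
      ∀ {Ω : Type*} [MeasurableSpace Ω] (P : Measure Ω) [IsProbabilityMeasure P]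
        (V : Fin n → Ω → Grassmannian k d), iIndepFun V P →
        (∀ j, HasLaw (V j) (sigma k d hkd.le) P) →
        1 - Real.exp (-(C * (n : ℝ))) ≤
          P.real {ω | ∀ X : Matrix (Fin d) (Fin d) ℝ, X.IsSymm → X.rank ≤ 2 →
            n * u * opNorm X ≤ l1Norm (measurement (fun j => V j ω) X)} := by
  obtain ⟨u, κ, hu, hκ, hlow⟩ := exists_lower_tail k hk
  -- Since 2 ≤ e, this gives (2 exp(-a))ⁿ ≤ exp(-κn), matching the lower tail.
  set a := κ + 1 with ha
  obtain ⟨m, hm⟩ : ∃ m : ℕ, 80 * a * (1 / 2) ^ m ≤ u / 2 := by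
    obtain ⟨m, hm⟩ := exists_pow_lt_of_lt_one (show 0 < u / 2 / (80 * a) by positivity)
      (show (1 / 2 : ℝ) < 1 by norm_num)
    refine ⟨m, ?_⟩
    rw [lt_div_iff₀ (by positivity)] at hm
    linarith
  set K : ℝ := 25 ^ (m + 1) with hK
  have hK1 : (25 : ℝ) ≤ K := by
    rw [hK, pow_succ]
    have : (1 : ℝ) ≤ 25 ^ m := one_le_pow₀ (by norm_num)
    linarith
  have hlogK : 0 < Real.log K := Real.log_pos (by linarith)
  -- Half of the rate κ is spent on the cardinality of the nets, using 3Kᵈ ≤ exp((2 + log K)d).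
  refine ⟨u / 2, 2 * (2 + Real.log K) / κ, κ / 2, by positivity, by positivity, by positivity, ?_⟩
  intro d hkd n hn Ω _ P _ V hind hlaw
  obtain ⟨s, hscard, hs1, hsnet⟩ := exists_ball_net d 1
  obtain ⟨t, htcard, ht, htnet⟩ := exists_pair_net d m
  set S := {ω | ∀ X : Matrix (Fin d) (Fin d) ℝ, X.IsSymm → X.rank ≤ 2 →
    n * (u / 2) * opNorm X ≤ l1Norm (measurement (fun j => V j ω) X)} with hS
  let B₁ : EuclideanSpace ℝ (Fin d) → Set Ω := fun y =>
    {ω | n * (4 * a) ≤ ∑ j, (d : ℝ) / k * (V j ω).form y y}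
  let B₂ : ℝ → EuclideanSpace ℝ (Fin d) × EuclideanSpace ℝ (Fin d) → Set Ω := fun e p =>
    {ω | ∑ j, |(V j ω).pairing p.1 p.2 e| ≤ n * u}
  have hsub : Sᶜ ⊆ (⋃ y ∈ s, B₁ y) ∪ ⋃ e ∈ ({1, -1} : Finset ℝ), ⋃ p ∈ t, B₂ e p := by
    intro ω hω
    by_contra hnot
    apply hω
    simp only [Set.mem_union, Set.mem_iUnion, not_or, not_exists] at hnot
    exact lower_bound_of_nets (by omega) (fun j => V j ω) (by positivity) hm s
      (by simpa using hsnet) t ht htnet (fun y hy => not_le.mp (hnot.1 y hy))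
      fun e he p hp => not_le.mp (hnot.2 e he p hp)
  have hB₁ : ∀ y ∈ s, P.real (B₁ y) ≤ Real.exp (-(κ * n)) := by
    intro y hy
    refine (upper_tail hk hkd.le P V hind hlaw y (hs1 y hy) a).trans ?_
    have h2 : (2 : ℝ) ≤ Real.exp 1 := by linarith [Real.add_one_le_exp (1 : ℝ)]
    calc (Real.exp (-a) * 2) ^ n ≤ (Real.exp (-a) * Real.exp 1) ^ n := by gcongr
      _ = Real.exp (-(κ * n)) := by
          rw [← Real.exp_add, ← Real.exp_nat_mul, ha]
          ring_nf
  have hB₂ : ∀ e ∈ ({1, -1} : Finset ℝ), ∀ p ∈ t, P.real (B₂ e p) ≤ Real.exp (-(κ * n)) := by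
    intro e he p hp
    obtain ⟨y, c, hx, hy, hxy, hc, hc1, hpy⟩ := ht p hp
    have hec : |e * c ^ 2| ≤ 1 := by
      have he1 : |e| = 1 := by
        rcases Finset.mem_insert.mp he with rfl | h
        · simp
        · simp [Finset.mem_singleton.mp h]
      rw [abs_mul, he1, one_mul, abs_of_nonneg (by positivity)]
      exact pow_le_one₀ hc hc1
    have := hlow d hkd n P V hind hlaw p.1 y (e * c ^ 2) hx hy hxy hec
    simpa only [B₂, hpy, pairing_smul] using this
  -- One family of events for the ball net (25ᵈ ≤ Kᵈ points) and two, one per sign, for the pair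
  -- net.
  have hU : P.real Sᶜ ≤ 3 * K ^ d * Real.exp (-(κ * n)) := by
    refine (measureReal_mono hsub).trans ((measureReal_union_le _ _).trans ?_)
    have h1 : P.real (⋃ y ∈ s, B₁ y) ≤ K ^ d * Real.exp (-(κ * n)) := by
      refine (measureReal_biUnion_finset_le _ _).trans ((Finset.sum_le_card_nsmul _ _ _ hB₁).trans ?_)
      rw [nsmul_eq_mul]
      gcongr
      calc (s.card : ℝ) ≤ (((5 ^ (1 + 1)) ^ d : ℕ) : ℝ) := by exact_mod_cast hscard
        _ = 25 ^ d := by push_cast; norm_num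
        _ ≤ K ^ d := by gcongr
    have h2 : ∀ e ∈ ({1, -1} : Finset ℝ),
        P.real (⋃ p ∈ t, B₂ e p) ≤ K ^ d * Real.exp (-(κ * n)) := by
      intro e he
      refine (measureReal_biUnion_finset_le _ _).trans
        ((Finset.sum_le_card_nsmul _ _ _ (hB₂ e he)).trans ?_)
      rw [nsmul_eq_mul]
      gcongr
      rw [hK]
      exact_mod_cast htcard
    have h3 : P.real (⋃ e ∈ ({1, -1} : Finset ℝ), ⋃ p ∈ t, B₂ e p) ≤
        2 * (K ^ d * Real.exp (-(κ * n))) := by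
      refine (measureReal_biUnion_finset_le _ _).trans
        ((Finset.sum_le_card_nsmul _ _ _ h2).trans (le_of_eq ?_))
      rw [Finset.card_pair (by norm_num), nsmul_eq_mul]
      norm_num
    linarith
  have hfin : 3 * K ^ d * Real.exp (-(κ * n)) ≤ Real.exp (-(κ / 2 * n)) := by
    have hd1 : (1 : ℝ) ≤ d := by exact_mod_cast (by omega : 1 ≤ d)
    have h3 : (3 : ℝ) ≤ Real.exp (2 * d) := by
      linarith [Real.add_one_le_exp (2 * (d : ℝ))]
    have hKd : K ^ d = Real.exp (d * Real.log K) := by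
      rw [Real.exp_nat_mul, Real.exp_log (by linarith)]
    have hn' : 2 * (2 + Real.log K) * d ≤ κ * n := by
      rw [div_mul_eq_mul_div, div_le_iff₀ hκ] at hn
      linarith
    calc 3 * K ^ d * Real.exp (-(κ * n))
        ≤ Real.exp (2 * d) * Real.exp (d * Real.log K) * Real.exp (-(κ * n)) := by
          rw [hKd]
          gcongr
      _ = Real.exp (2 * d + d * Real.log K - κ * n) := by
          rw [← Real.exp_add, ← Real.exp_add, sub_eq_add_neg]
      _ ≤ _ := by
          rw [Real.exp_le_exp]
          linarith
  -- Subadditivity avoids any measurability claim about S, an intersection over all X.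
  have hone : (1 : ℝ) ≤ P.real S + P.real Sᶜ := by
    have := measureReal_union_le (μ := P) S Sᶜ
    rwa [Set.union_compl_self, probReal_univ] at this
  linarith


end PhaseRetrieval

theorem theorem5p6 (k : ℕ) (hk : 1 ≤ k) :
    ∃ u : ℝ, 0 < u ∧ ∀ r : ℝ, 0 < r → r < 1 →
      ∃ c C : ℝ, 0 < c ∧ 0 < C ∧
        ∀ (d : ℕ) (hkd : k < d) (n : ℕ), c * (d : ℝ) ≤ (n : ℝ) →
          ∀ {Ω : Type*} [MeasurableSpace Ω] (P : Measure Ω) [IsProbabilityMeasure P]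
            (V : Fin n → Ω → PhaseRetrieval.Grassmannian k d),
            iIndepFun V P →
            (∀ j, HasLaw (V j) (PhaseRetrieval.sigma k d hkd.le) P) →
            1 - Real.exp (-(C * (n : ℝ))) ≤
              P.real {ω | ∀ X : Matrix (Fin d) (Fin d) ℝ, X.IsSymm → X.rank ≤ 2 →
                u * (1 - r) * PhaseRetrieval.opNorm X ≤
                  1 / (n : ℝ) *
                    PhaseRetrieval.l1Norm (PhaseRetrieval.measurement (fun j => V j ω) X)} := by
  obtain ⟨u, c, C, hu, hc, hC, H⟩ := PhaseRetrieval.exists_uniform_lower_bound k hk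
  -- The same c and C serve every r.
  refine ⟨u, hu, fun r hr hr1 => ⟨c, C, hc, hC, ?_⟩⟩
  intro d hkd n hn Ω _ P _ V hind hlaw
  refine (H d hkd n hn P V hind hlaw).trans (measureReal_mono ?_)
  intro ω hω X hX hrank
  have hd0 : (0 : ℝ) < d := by exact_mod_cast (by omega : 0 < d)
  have hn0 : (0 : ℝ) < n := (mul_pos hc hd0).trans_le hn
  have h0 : 0 ≤ PhaseRetrieval.opNorm X := norm_nonneg _
  rw [one_div, le_inv_mul_iff₀ hn0]
  refine le_trans ?_ (hω X hX hrank)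
  rw [← mul_assoc]
  refine mul_le_mul_of_nonneg_right ?_ h0
  refine mul_le_mul_of_nonneg_left ?_ hn0.le
  exact mul_le_of_le_one_right hu.le (by linarith)
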